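/- **Notation.** Operators are bounded linear maps on complex Hilbert spaces. Let $\pi(z_1,z_2)=(z_1+z_2,z_1z_2)$, $\mathbb G_2=\pi(\mathbb D^2)$, $\Gamma=\pi(\overline{\mathbb D}^2)$, $b\Gamma=\pi(\mathbb T^2)$, and let $\partial\Gamma$ be the topological boundary of $\Gamma$ in $\mathbb C^2$. A commuting pair $(S,P)$ of operators is a *$\Gamma$-contraction* if its Taylor joint spectrum is contained in $\Gamma$ and $\|f(S,P)\|\le\sup_{\Gamma}|f|$ for every rational function $f=p/q$ with $p,q\in\mathbb C[z_1,z_2]$ and $q$ without zeros in $\Gamma$. A polynomial $p\in\mathbb C[z_1,z_2]$ with zero set $Z(p)$ is *$\Gamma$-distinguished* if $Z(p)\cap\mathbb G_2\neq\emptyset$ and $Z(p)\cap\partial\Gamma=Z(p)\cap b\Gamma$; a $\Gamma$-contraction is *$\Gamma$-distinguished* if it is annihilated by some $\Gamma$-distinguished polynomial. For a contraction $P$ put $D_P=(I-P^*P)^{1/2}$ and $\mathcal D_P=\overline{\operatorname{Ran}}\,D_P$. The *fundamental operator* of a $\Gamma$-contraction $(S,P)$ is the unique operator $A$ on $\mathcal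 D_P$ with $S-S^*P=D_PAD_P$. **Lemma.** Let $(S,P)$ be a $\Gamma$-contraction on a Hilbert space $\mathcal H$ with fundamental operator $A$, and suppose that $(S,P)$ and $(A,0)$ are both $\Gamma$-distinguished $\Gamma$-contractions. On $\mathcal H\oplus\ell^2(\mathcal D_P)$ define $$T_A(x_0,x_1,x_2,\dots)=(Sx_0,\;A^*D_Px_0+Ax_1,\;A^*x_1+Ax_2,\;A^*x_2+Ax_3,\dots),$$ $$V_0(x_0,x_1,x_2,\dots)=(Px_0,\;D_Px_0,\;x_1,\;x_2,\dots),$$ and, for every integer $n\ge 1$, $$T_n(x_0,x_1,x_2,\dots)=(Sx_0,\;A^*D_Px_0+Ax_1,\;A^*x_1+Ax_2,\;\dots,\;A^*x_{n-1}+Ax_n,\;0,\;0,\dots),$$ $$V_n(x_0,x_1,x_2,\dots)=(Px_0,\;D_Px_0,\;x_1,\;\dots,\;x_{n-1},\;0,\;0,\dots).$$ Then $(T_n,V_n)$ is a $\Gamma$-distinguished $\Gamma$-contraction on $\mathcal H\oplus\ell^2(\mathcal D_P)$ for every $n\ge1$, and $T_n\to T_A$ and $V_n\to V_0$ in the strong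 operator topology as $n\to\infty$. -/

import Mathlib

open Filter Topology

noncomputable section

/-! ### The symmetrized bidisc and distinguished polynomials -/

/-- The symmetrization map `π(z₁, z₂) = (z₁ + z₂, z₁ z₂)`. -/
def symmMap (z : ℂ × ℂ) : ℂ × ℂ := (z.1 + z.2, z.1 * z.2)

/-- The open symmetrized bidisc `𝔾₂ = π(𝔻²)`. -/
def symmBidisc : Set (ℂ × ℂ) := symmMap '' {z | ‖z.1‖ < 1 ∧ ‖z.2‖ < 1}

/-- The closed symmetrized bidisc `Γ`, the image under `π` of the closed bidisc. -/
def closedSymmBidisc : Set (ℂ × ℂ) := symmMap '' {z | ‖z.1‖ ≤ 1 ∧ ‖z.2‖ ≤ 1}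

/-- The distinguished boundary `bΓ = π(𝕋²)`. -/
def distBoundary : Set (ℂ × ℂ) := symmMap '' {z | ‖z.1‖ = 1 ∧ ‖z.2‖ = 1}

/-- The value `p(s, p)` of a polynomial in two variables at a point of `ℂ²`. -/
def evalPt (p : MvPolynomial (Fin 2) ℂ) (z : ℂ × ℂ) : ℂ := MvPolynomial.eval ![z.1, z.2] p

/-- The zero set `Z(p)` in `ℂ²`. -/
def zeroSet (p : MvPolynomial (Fin 2) ℂ) : Set (ℂ × ℂ) := {z | evalPt p z = 0}

/-- A polynomial is `Γ`-distinguished if `Z(p)` meets `𝔾₂` and `Z(p) ∩ ∂Γ = Z(p) ∩ bΓ`. -/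
def IsGammaDistinguishedPoly (p : MvPolynomial (Fin 2) ℂ) : Prop :=
  (zeroSet p ∩ symmBidisc).Nonempty ∧
    zeroSet p ∩ frontier closedSymmBidisc = zeroSet p ∩ distBoundary

/-! ### Pairs of operators -/

section Pairs

variable {H : Type*} [NormedAddCommGroup H] [InnerProductSpace ℂ H]

/-- `p(S, P) = ∑ c_{ij} Sⁱ Pʲ` for `p = ∑ c_{ij} z₁ⁱ z₂ʲ`. -/
def evalOp (S P : H →L[ℂ] H) (p : MvPolynomial (Fin 2) ℂ) : H →L[ℂ] H :=
  ∑ m ∈ p.support, p.coeff m • (S ^ m 0 * P ^ m 1)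

/-- First map of the Koszul complex `0 → H → H × H → H → 0` of a pair. -/
def koszulOne (S P : H →L[ℂ] H) : H →L[ℂ] H × H := S.prod P

/-- Second map of the Koszul complex of a pair, `(x, y) ↦ S y - P x`. -/
def koszulTwo (S P : H →L[ℂ] H) : H × H →L[ℂ] H :=
  S ∘L ContinuousLinearMap.snd ℂ H H - P ∘L ContinuousLinearMap.fst ℂ H H

/-- Exactness of the Koszul complex `0 → H → H × H → H → 0` of a pair. -/
def KoszulExact (S P : H →L[ℂ] H) : Prop :=
  Function.Injective (koszulOne S P) ∧
    Function.Exact (koszulOne S P) (koszulTwo S P) ∧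
      Function.Surjective (koszulTwo S P)

/-- The Taylor joint spectrum of a commuting pair: the points `(s, p)` for which the Koszul
complex of `(S - s, P - p)` is not exact. -/
def taylorSpectrum (S P : H →L[ℂ] H) : Set (ℂ × ℂ) :=
  {z | ¬ KoszulExact (S - z.1 • (1 : H →L[ℂ] H)) (P - z.2 • (1 : H →L[ℂ] H))}

/-- The norm `‖p / q‖_{∞, Γ}` of a rational function on `Γ` (used for `q` without zeros in `Γ`, so
that the supremum is over a nonempty bounded set). -/
def gammaSupNorm (p q : MvPolynomial (Fin 2) ℂ) : ℝ :=
  sSup ((fun z => ‖evalPt p z / evalPt q z‖) '' closedSymmBidisc)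

/-- A `Γ`-contraction: a commuting pair that has `Γ` as a spectral set.  The Taylor joint spectrum
lies in `Γ`, and for each rational function `p / q` with `q` zero-free on `Γ` the operator
`(p / q)(S, P) = p(S, P) q(S, P)⁻¹` (where `q(S, P)` is invertible) satisfies von Neumann's
inequality on `Γ`. -/
structure IsGammaContraction (S P : H →L[ℂ] H) : Prop where
  commute : Commute S P
  taylorSpectrum_subset : taylorSpectrum S P ⊆ closedSymmBidisc
  vonNeumann : ∀ p q : MvPolynomial (Fin 2) ℂ, (∀ z ∈ closedSymmBidisc, evalPt q z ≠ 0) →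
    IsUnit (evalOp S P q) ∧
      ‖evalOp S P p * Ring.inverse (evalOp S P q)‖ ≤ gammaSupNorm p q

/-- A `Γ`-distinguished `Γ`-contraction: a `Γ`-contraction annihilated by some `Γ`-distinguished
polynomial. -/
def IsGammaDistinguished (S P : H →L[ℂ] H) : Prop :=
  IsGammaContraction S P ∧
    ∃ p : MvPolynomial (Fin 2) ℂ, IsGammaDistinguishedPoly p ∧ evalOp S P p = 0

end Pairs

/-! ### Defect operator, defect space, fundamental operator -/

section Defect

variable {H : Type*} [NormedAddCommGroup H] [InnerProductSpace ℂ H] [CompleteSpace H]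

/-- The defect operator `D_P = (I - P* P)^{1/2}` of a contraction `P`. -/
def defectOp (P : H →L[ℂ] H) : H →L[ℂ] H :=
  CFC.sqrt (1 - ContinuousLinearMap.adjoint P * P)

/-- The defect space `𝒟_P`, the closure of the range of `D_P`. -/
abbrev defectSpace (P : H →L[ℂ] H) : Submodule ℂ H :=
  (LinearMap.range (defectOp P).toLinearMap).topologicalClosure

/-- `D_P` as an operator from `H` to `𝒟_P`. -/
def defectMap (P : H →L[ℂ] H) : H →L[ℂ] defectSpace P :=
  (defectOp P).codRestrict (defectSpace P)
    fun x => Submodule.le_topologicalClosure _ ⟨x, rfl⟩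

/-- `A ∈ B(𝒟_P)` solves the fundamental equation `S - S* P = D_P A D_P`.  Such an `A` is unique
(see `IsFundamentalOperator.unique`). -/
def IsFundamentalOperator (S P : H →L[ℂ] H) (A : defectSpace P →L[ℂ] defectSpace P) : Prop :=
  ∀ x : H, S x - ContinuousLinearMap.adjoint S (P x) =
    defectOp P (A (defectMap P x) : defectSpace P)

end Defect

/-! ### Operators on `ℓ²(E)` and on `H ⊕ ℓ²(E)` -/

section Blocks

variable {H E : Type*} [NormedAddCommGroup H] [InnerProductSpace ℂ H]
  [NormedAddCommGroup E] [InnerProductSpace ℂ E]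

variable (E) in
/-- The Hilbert space `ℓ²(E)` of square summable sequences in `E`. -/
abbrev ell2 : Type _ := lp (fun _ : ℕ => E) 2

variable (H E) in
/-- The Hilbert space direct sum `H ⊕ ℓ²(E)`; its element `(x₀, x₁, x₂, …)` has `x₀` as its first
component, and `x_{j+1}` as entry `j` of its second component. -/
abbrev dilationSpace : Type _ := WithLp 2 (H × ell2 E)

/-- The block diagonal operator `(x₀, x₁, …) ↦ (A x₀, A x₁, …)` on `ℓ²(E)`. -/
def diagOp (A : E →L[ℂ] E) : ell2 E →L[ℂ] ell2 E :=
  lp.mapCLM 2 (fun _ : ℕ => A) (norm_nonneg A) fun _ => le_rfl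

/-- The truncation `(x₀, x₁, …) ↦ (x₀, …, x_{n-1}, 0, 0, …)` on `ℓ²(E)`. -/
def truncOp (n : ℕ) : ell2 E →L[ℂ] ell2 E :=
  lp.mapCLM 2 (fun j : ℕ => if j < n then ContinuousLinearMap.id ℂ E else 0) zero_le_one
    fun j => by
      split_ifs
      · exact ContinuousLinearMap.norm_id_le
      · simp

/-- The sequence `(0, x₀, x₁, …)`. -/
def shiftSeq (x : ℕ → E) : ℕ → E
  | 0 => 0
  | j + 1 => x j

theorem hasSum_shiftSeq {E : Type*} [NormedAddCommGroup E] (x : lp (fun _ : ℕ => E) 2) :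
    HasSum (fun j => ‖shiftSeq x j‖ ^ (2 : ENNReal).toReal) (‖x‖ ^ (2 : ENNReal).toReal) := by
  have h := lp.hasSum_norm (p := 2) (by norm_num) x
  refine (hasSum_nat_add_iff' 1).1 ?_
  simpa [shiftSeq] using h

/-- The forward shift `(x₀, x₁, …) ↦ (0, x₀, x₁, …)` on `ℓ²(E)`. -/
def shiftOp : ell2 E →L[ℂ] ell2 E :=
  LinearMap.mkContinuous
    { toFun := fun x => ⟨shiftSeq x, memℓp_gen (hasSum_shiftSeq x).summable⟩
      map_add' := fun x y => lp.ext (funext fun j => match j with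
        | 0 => (add_zero (0 : E)).symm
        | _ + 1 => rfl)
      map_smul' := fun c x => lp.ext (funext fun j => match j with
        | 0 => (smul_zero c).symm
        | _ + 1 => rfl) }
    1 fun x => by
      refine lp.norm_le_of_tsum_le (by norm_num) (by positivity) ?_
      rw [one_mul]
      exact (hasSum_shiftSeq x).tsum_eq.le

/-- The operator with block matrix `[[T, 0], [C, D]]` on `H ⊕ ℓ²(E)`. -/
def lowerBlock (T : H →L[ℂ] H) (C : H →L[ℂ] ell2 E) (D : ell2 E →L[ℂ] ell2 E) :
    dilationSpace H E →L[ℂ] dilationSpace H E :=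
  (WithLp.prodContinuousLinearEquiv 2 ℂ H (ell2 E)).symm.toContinuousLinearMap ∘L
    ((T ∘L WithLp.fstL 2 ℂ H (ell2 E)).prod
      (C ∘L WithLp.fstL 2 ℂ H (ell2 E) + D ∘L WithLp.sndL 2 ℂ H (ell2 E)))

end Blocks

/-! ### The dilation `(T_A, V₀)` and its truncations `(T_n, V_n)` -/

section Dilation

variable {H : Type*} [NormedAddCommGroup H] [InnerProductSpace ℂ H] [CompleteSpace H]

/-- The column `C = [A* D_P, 0, 0, …]ᵗ`. -/
def colC (P : H →L[ℂ] H) (A : defectSpace P →L[ℂ] defectSpace P) :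
    H →L[ℂ] ell2 (defectSpace P) :=
  lp.singleContinuousLinearMap ℂ (fun _ : ℕ => defectSpace P) 2 0 ∘L
    ContinuousLinearMap.adjoint A ∘L defectMap P

/-- The column `B = [D_P, 0, 0, …]ᵗ`. -/
def colB (P : H →L[ℂ] H) : H →L[ℂ] ell2 (defectSpace P) :=
  lp.singleContinuousLinearMap ℂ (fun _ : ℕ => defectSpace P) 2 0 ∘L defectMap P

/-- The block Toeplitz operator `D` with `A` on the diagonal and `A*` on the subdiagonal. -/
def toeplitzD {E : Type*} [NormedAddCommGroup E] [InnerProductSpace ℂ E] [CompleteSpace E]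
    (A : E →L[ℂ] E) : ell2 E →L[ℂ] ell2 E :=
  diagOp A + shiftOp ∘L diagOp (ContinuousLinearMap.adjoint A)

/-- `T_A (x₀, x₁, x₂, …) = (S x₀, A* D_P x₀ + A x₁, A* x₁ + A x₂, A* x₂ + A x₃, …)`. -/
def dilT (S P : H →L[ℂ] H) (A : defectSpace P →L[ℂ] defectSpace P) :
    dilationSpace H (defectSpace P) →L[ℂ] dilationSpace H (defectSpace P) :=
  lowerBlock S (colC P A) (toeplitzD A)

/-- `V₀ (x₀, x₁, x₂, …) = (P x₀, D_P x₀, x₁, x₂, …)`. -/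
def dilV (P : H →L[ℂ] H) :
    dilationSpace H (defectSpace P) →L[ℂ] dilationSpace H (defectSpace P) :=
  lowerBlock P (colB P) shiftOp

/-- For `n ≥ 1`,
`T_n (x₀, x₁, …) = (S x₀, A* D_P x₀ + A x₁, A* x₁ + A x₂, …, A* x_{n-1} + A x_n, 0, 0, …)`. -/
def truncT (S P : H →L[ℂ] H) (A : defectSpace P →L[ℂ] defectSpace P) (n : ℕ) :
    dilationSpace H (defectSpace P) →L[ℂ] dilationSpace H (defectSpace P) :=
  lowerBlock S (colC P A) (truncOp n ∘L toeplitzD A)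

/-- For `n ≥ 1`, `V_n (x₀, x₁, …) = (P x₀, D_P x₀, x₁, …, x_{n-1}, 0, 0, …)`. -/
def truncV (P : H →L[ℂ] H) (n : ℕ) :
    dilationSpace H (defectSpace P) →L[ℂ] dilationSpace H (defectSpace P) :=
  lowerBlock P (colB P) (truncOp n ∘L shiftOp)

end Dilation

/-! ### The coordinates of the operators just defined -/

section Coordinates

variable {H : Type*} [NormedAddCommGroup H] [InnerProductSpace ℂ H] [CompleteSpace H]

/-- The fundamental equation has at most one solution. -/
theorem IsFundamentalOperator.unique {S P : H →L[ℂ] H}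
    {A A' : defectSpace P →L[ℂ] defectSpace P} (h : IsFundamentalOperator S P A)
    (h' : IsFundamentalOperator S P A') : A = A' := by
  have hself : ∀ u v : H, inner ℂ (defectOp P u) v = inner ℂ u (defectOp P v) := fun u v =>
    (ContinuousLinearMap.isSelfAdjoint_iff_isSymmetric.1
      (IsSelfAdjoint.of_nonneg (CFC.sqrt_nonneg _))) u v
  have hker : ∀ y : defectSpace P, defectOp P y = 0 → y = 0 := fun y hy => by
    have h1 : (y : H) ∈ (defectSpace P)ᗮ := by
      rw [Submodule.orthogonal_closure, Submodule.mem_orthogonal]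
      rintro _ ⟨z, rfl⟩
      exact (hself z y).trans (by rw [hy, inner_zero_right])
    have h2 : (y : H) ∈ defectSpace P ⊓ (defectSpace P)ᗮ := ⟨y.2, h1⟩
    rw [Submodule.inf_orthogonal_eq_bot] at h2
    exact Subtype.ext h2
  have hdense : DenseRange (defectMap P) := by
    intro y
    rw [Topology.IsInducing.subtypeVal.closure_eq_preimage_closure_image]
    have hy : (y : H) ∈ closure (Set.range (defectOp P)) := y.2
    convert hy using 2
    rw [← Set.range_comp]
    rfl
  have hfun : (A : defectSpace P → defectSpace P) = A' :=
    hdense.equalizer A.continuous A'.continuous <| funext fun x => by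
      refine sub_eq_zero.1 (hker _ ?_)
      rw [Submodule.coe_sub, map_sub]
      exact sub_eq_zero.2 ((h x).symm.trans (h' x))
  exact ContinuousLinearMap.ext fun y => congrFun hfun y

@[simp] theorem diagOp_apply {E : Type*} [NormedAddCommGroup E] [InnerProductSpace ℂ E]
    (A : E →L[ℂ] E) (x : ell2 E) (j : ℕ) : diagOp A x j = A (x j) := rfl

@[simp] theorem truncOp_apply {E : Type*} [NormedAddCommGroup E] [InnerProductSpace ℂ E]
    (n : ℕ) (x : ell2 E) (j : ℕ) : truncOp n x j = if j < n then x j else 0 := by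
  change (if j < n then ContinuousLinearMap.id ℂ E else 0) (x j) = _
  split_ifs <;> rfl

@[simp] theorem shiftOp_zero {E : Type*} [NormedAddCommGroup E] [InnerProductSpace ℂ E]
    (x : ell2 E) : shiftOp x 0 = 0 := rfl

@[simp] theorem shiftOp_succ {E : Type*} [NormedAddCommGroup E] [InnerProductSpace ℂ E]
    (x : ell2 E) (j : ℕ) : shiftOp x (j + 1) = x j := rfl

variable (S P : H →L[ℂ] H) (A : defectSpace P →L[ℂ] defectSpace P)
  (x : dilationSpace H (defectSpace P)) (n j : ℕ)

theorem dilT_fst : (dilT S P A x).fst = S x.fst := rfl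

theorem dilT_snd_zero : (dilT S P A x).snd 0 =
    ContinuousLinearMap.adjoint A (defectMap P x.fst) + A (x.snd 0) := by
  simp [dilT, lowerBlock, colC, toeplitzD]

theorem dilT_snd_succ : (dilT S P A x).snd (j + 1) =
    ContinuousLinearMap.adjoint A (x.snd j) + A (x.snd (j + 1)) := by
  simp [dilT, lowerBlock, colC, toeplitzD]
  exact add_comm _ _

theorem dilV_fst : (dilV P x).fst = P x.fst := rfl

theorem dilV_snd_zero : (dilV P x).snd 0 = defectMap P x.fst := by
  simp [dilV, lowerBlock, colB]

theorem dilV_snd_succ : (dilV P x).snd (j + 1) = x.snd j := by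
  simp [dilV, lowerBlock, colB]

theorem truncT_fst : (truncT S P A n x).fst = S x.fst := rfl

theorem truncT_snd_zero : (truncT S P A (n + 1) x).snd 0 =
    ContinuousLinearMap.adjoint A (defectMap P x.fst) + A (x.snd 0) := by
  simp [truncT, lowerBlock, colC, toeplitzD]

theorem truncT_snd_succ : (truncT S P A n x).snd (j + 1) =
    if j + 1 < n then ContinuousLinearMap.adjoint A (x.snd j) + A (x.snd (j + 1)) else 0 := by
  simp [truncT, lowerBlock, colC, toeplitzD]
  split_ifs
  · exact add_comm _ _
  · exact add_zero 0

theorem truncV_fst : (truncV P n x).fst = P x.fst := rfl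

theorem truncV_snd_zero : (truncV P n x).snd 0 = defectMap P x.fst := by
  simp [truncV, lowerBlock, colB]

theorem truncV_snd_succ : (truncV P n x).snd (j + 1) = if j + 1 < n then x.snd j else 0 := by
  simp [truncV, lowerBlock, colB]

end Coordinates

end

noncomputable section

/-! ### The geometry of the symmetrized bidisc -/

/-! `V₀` is an isometry commuting with `T_A`, and `T_A = T_A* V₀` (`isToeplitzPair_dilT_dilV`). In
the algebra generated by such a pair every `a` has the form `b* V₀ ^ m` with `b` in the algebra,
which forces `‖a‖² ≤ ‖a²‖`; so norms equal spectral radii there.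

This is used twice. The powers of the triangular operator `T_A` grow at most like `k 2 ^ k`, because
its diagonal blocks `S` and `toeplitzD A` have norm at most `2` (for the latter, `(A, 0)` being a
`Γ`-contraction bounds the numerical radius of `A` by `1`); hence `‖T_A‖ ≤ 2`. Next, the map `(s, p)
↦ (s² - 2p, p²)` preserves such pairs and the bound `2`, so all power sums `z₁ ^ 2 ^ k + z₂ ^ 2 ^ k`
take norm at most `2` at `(T_A, V₀)`. These inequalities and `|p| ≤ 1` cut out `Γ`, so Gelfand
theory yields von Neumann's inequality on `Γ` for polynomials, and polynomial convexity extends it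
to rational functions (`Commute.isGammaContraction`).

With `Q` the projection onto the entries `x₀, …, xₙ`, `(T_n, V_n) = (Q T_A, Q V₀)` is a compression
to a coinvariant subspace plus the zero pair, and inherits the inequality. If `p` annihilates `(S,
P)` and `q` annihilates `(A, 0)`, triangularity makes `qⁿ p` annihilate the compression; the extra
factor `s`, itself distinguished, kills the zero summand. Strong convergence is that of the
truncations of `ℓ²` to the identity. -/

theorem isCompact_closedSymmBidisc : IsCompact closedSymmBidisc := by
  have h : {z : ℂ × ℂ | ‖z.1‖ ≤ 1 ∧ ‖z.2‖ ≤ 1} =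
      Metric.closedBall (0 : ℂ) 1 ×ˢ Metric.closedBall (0 : ℂ) 1 := by
    ext z; simp
  unfold closedSymmBidisc
  rw [h]
  refine ((isCompact_closedBall _ _).prod (isCompact_closedBall _ _)).image ?_
  unfold symmMap
  fun_prop

theorem zero_mem_closedSymmBidisc : (0 : ℂ × ℂ) ∈ closedSymmBidisc :=
  ⟨0, by simp, by simp [symmMap]⟩

theorem norm_fst_le_of_mem {z : ℂ × ℂ} (hz : z ∈ closedSymmBidisc) : ‖z.1‖ ≤ 2 := by
  obtain ⟨w, ⟨h1, h2⟩, rfl⟩ := hz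
  exact (norm_add_le _ _).trans (by linarith)

theorem norm_snd_le_of_mem {z : ℂ × ℂ} (hz : z ∈ closedSymmBidisc) : ‖z.2‖ ≤ 1 := by
  obtain ⟨w, ⟨h1, h2⟩, rfl⟩ := hz
  simpa [symmMap] using mul_le_one₀ h1 (norm_nonneg _) h2

theorem exists_symmMap_eq (z : ℂ × ℂ) : ∃ w, symmMap w = z := by
  -- `d` is a square root of the discriminant of `X² - z.1 X + z.2`.
  obtain ⟨d, hd⟩ := IsAlgClosed.exists_eq_mul_self (z.1 ^ 2 - 4 * z.2)
  refine ⟨((z.1 + d) / 2, (z.1 - d) / 2), Prod.ext ?_ ?_⟩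
  · simp only [symmMap]; ring
  · simp only [symmMap]; linear_combination hd / 4

/-- The polynomial `τ` with `τ (z₁ + z₂, z₁ z₂) = z₁ ^ 2 ^ k + z₂ ^ 2 ^ k`. -/
def powerSumPoly : ℕ → MvPolynomial (Fin 2) ℂ
  | 0 => .X 0
  | k + 1 => powerSumPoly k ^ 2 - 2 * .X 1 ^ 2 ^ k

theorem evalPt_powerSumPoly (k : ℕ) (w : ℂ × ℂ) :
    evalPt (powerSumPoly k) (symmMap w) = w.1 ^ 2 ^ k + w.2 ^ 2 ^ k := by
  induction k with
  | zero => simp [powerSumPoly, evalPt, symmMap]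
  | succ k ih =>
    have : evalPt (powerSumPoly (k + 1)) (symmMap w) =
        evalPt (powerSumPoly k) (symmMap w) ^ 2 - 2 * (w.1 * w.2) ^ 2 ^ k := by
      simp [powerSumPoly, evalPt, symmMap]
    rw [this, ih]
    ring

theorem norm_powerSumPoly_le_of_mem (k : ℕ) {z : ℂ × ℂ} (hz : z ∈ closedSymmBidisc) :
    ‖evalPt (powerSumPoly k) z‖ ≤ 2 := by
  obtain ⟨w, ⟨h1, h2⟩, rfl⟩ := hz
  rw [evalPt_powerSumPoly]
  refine (norm_add_le _ _).trans ?_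
  rw [norm_pow, norm_pow]
  have := pow_le_one₀ (n := 2 ^ k) (norm_nonneg _) h1
  have := pow_le_one₀ (n := 2 ^ k) (norm_nonneg _) h2
  linarith

/-- `Γ` is cut out by the inequalities `|τ| ≤ 2` for the power sums and `|p| ≤ 1`; in particular it
is polynomially convex. -/
theorem mem_closedSymmBidisc_of_forall {z : ℂ × ℂ}
    (h1 : ∀ k, ‖evalPt (powerSumPoly k) z‖ ≤ 2) (h2 : ‖z.2‖ ≤ 1) : z ∈ closedSymmBidisc := by
  obtain ⟨w, rfl⟩ := exists_symmMap_eq z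
  have key : ∀ u v : ℂ, (∀ k : ℕ, ‖u ^ 2 ^ k + v ^ 2 ^ k‖ ≤ 2) → ‖u * v‖ ≤ 1 → ‖u‖ ≤ 1 := by
    intro u v huv hp
    by_contra! hu
    -- Since `‖u v‖ ≤ 1 < ‖u‖`, powers of `v` stay in the unit disc, so a power of `u` beyond `3`
    -- makes the power sum exceed `3 - 1 = 2`.
    obtain ⟨n, hn⟩ := pow_unbounded_of_one_lt 3 hu
    have hn2 : (3 : ℝ) < ‖u‖ ^ 2 ^ n :=
      hn.trans_le (pow_le_pow_right₀ hu.le Nat.lt_two_pow_self.le)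
    have hv : ‖v‖ ^ 2 ^ n ≤ 1 := by
      refine pow_le_one₀ (norm_nonneg _) ?_
      rw [norm_mul] at hp
      nlinarith [norm_nonneg v]
    have h3 := norm_sub_le (u ^ 2 ^ n + v ^ 2 ^ n) (v ^ 2 ^ n)
    rw [add_sub_cancel_right, norm_pow, norm_pow] at h3
    linarith [huv n]
  simp only [evalPt_powerSumPoly] at h1
  exact ⟨w, ⟨key _ _ h1 h2, key w.2 w.1 (fun k => by rw [add_comm]; exact h1 k)
    (by rw [mul_comm]; exact h2)⟩, rfl⟩

/-! ### Suprema over `Γ` -/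

theorem continuous_evalPt (p : MvPolynomial (Fin 2) ℂ) : Continuous (evalPt p) := by
  have := MvPolynomial.continuous_eval p
  refine this.comp (continuous_pi fun i => ?_)
  fin_cases i
  · exact continuous_fst
  · exact continuous_snd

theorem norm_le_gammaSupNorm {p q : MvPolynomial (Fin 2) ℂ}
    (hq : ∀ z ∈ closedSymmBidisc, evalPt q z ≠ 0) {z : ℂ × ℂ} (hz : z ∈ closedSymmBidisc) :
    ‖evalPt p z / evalPt q z‖ ≤ gammaSupNorm p q :=
  le_csSup (isCompact_closedSymmBidisc.bddAbove_image
    ((continuous_evalPt p).continuousOn.div (continuous_evalPt q).continuousOn hq).norm)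
    ⟨z, hz, rfl⟩

theorem gammaSupNorm_le {p q : MvPolynomial (Fin 2) ℂ} {C : ℝ}
    (h : ∀ z ∈ closedSymmBidisc, ‖evalPt p z / evalPt q z‖ ≤ C) : gammaSupNorm p q ≤ C :=
  csSup_le (Set.Nonempty.image _ ⟨0, zero_mem_closedSymmBidisc⟩)
    (by rintro _ ⟨z, hz, rfl⟩; exact h z hz)

theorem gammaSupNorm_nonneg (p q : MvPolynomial (Fin 2) ℂ) : 0 ≤ gammaSupNorm p q :=
  Real.sSup_nonneg (by rintro _ ⟨z, -, rfl⟩; exact norm_nonneg _)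

@[simp] theorem evalPt_one (z : ℂ × ℂ) : evalPt 1 z = 1 := by simp [evalPt]

theorem evalPt_one_ne_zero (z : ℂ × ℂ) (_ : z ∈ closedSymmBidisc) : evalPt 1 z ≠ 0 := by simp

theorem norm_evalPt_le_gammaSupNorm (p : MvPolynomial (Fin 2) ℂ) {z : ℂ × ℂ}
    (hz : z ∈ closedSymmBidisc) : ‖evalPt p z‖ ≤ gammaSupNorm p 1 := by
  simpa using norm_le_gammaSupNorm (p := p) evalPt_one_ne_zero hz

theorem gammaSupNorm_one_le {p : MvPolynomial (Fin 2) ℂ} {C : ℝ}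
    (h : ∀ z ∈ closedSymmBidisc, ‖evalPt p z‖ ≤ C) : gammaSupNorm p 1 ≤ C :=
  gammaSupNorm_le fun z hz => by simpa using h z hz

/-! ### Distinguished polynomials -/

theorem IsGammaDistinguishedPoly.mul {p q : MvPolynomial (Fin 2) ℂ}
    (hp : IsGammaDistinguishedPoly p) (hq : IsGammaDistinguishedPoly q) :
    IsGammaDistinguishedPoly (p * q) := by
  have h : zeroSet (p * q) = zeroSet p ∪ zeroSet q := by
    ext z; simp [zeroSet, evalPt]
  refine ⟨?_, ?_⟩
  · rw [h, Set.union_inter_distrib_right]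
    exact hp.1.inl
  · rw [h, Set.union_inter_distrib_right, Set.union_inter_distrib_right, hp.2, hq.2]

/-- The points of `Γ` with `s = 0` are `(0, -w²)` with `‖w‖ ≤ 1`, so both boundaries meet this line
in the circle `‖w‖ = 1`. -/
theorem isGammaDistinguishedPoly_X : IsGammaDistinguishedPoly (.X 0) := by
  have hZ : ∀ z : ℂ × ℂ, z ∈ zeroSet (.X 0) ↔ z.1 = 0 := fun z => by simp [zeroSet, evalPt]
  refine ⟨⟨0, (hZ _).2 rfl, 0, by simp, by simp [symmMap]⟩, ?_⟩
  ext z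
  refine and_congr_right fun hz => ?_
  rw [hZ] at hz
  constructor
  · intro h
    obtain ⟨w, ⟨hw1, hw2⟩, rfl⟩ := isCompact_closedSymmBidisc.isClosed.frontier_subset h
    have hw : w.2 = -w.1 := by
      simp only [symmMap] at hz; linear_combination hz
    have hn : ‖w.2‖ = ‖w.1‖ := by rw [hw, norm_neg]
    rcases hw1.lt_or_eq with hlt | heq
    · exfalso
      -- The open set `|s| + |p| < 1` lies in `Γ`: a root `a` of `X² - s X + p` with `|a| > 1` would
      -- satisfy `|a|² ≤ |s||a| + |p| < |a|`.
      refine h.2 (mem_interior.2 ⟨{z | ‖z.1‖ + ‖z.2‖ < 1}, ?_, ?_, ?_⟩)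
      · intro z hz
        obtain ⟨v, rfl⟩ := exists_symmMap_eq z
        have key : ∀ a b : ℂ, ‖a + b‖ + ‖a * b‖ < 1 → ‖a‖ ≤ 1 := by
          intro a b hab
          by_contra! ha
          have h1 : ‖a‖ ^ 2 ≤ ‖a + b‖ * ‖a‖ + ‖a * b‖ := by
            rw [← norm_mul, ← norm_pow]
            have : a ^ 2 = (a + b) * a - a * b := by ring
            rw [this]; exact norm_sub_le _ _
          nlinarith [norm_nonneg (a * b)]
        exact ⟨v, ⟨key _ _ hz, key v.2 v.1 (by
          rw [add_comm v.2, mul_comm v.2]; exact hz)⟩, rfl⟩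
      · exact isOpen_lt (by fun_prop) continuous_const
      · simp only [Set.mem_ofPred_eq, symmMap, hw]
        simp only [add_neg_cancel, norm_zero, norm_mul, norm_neg]
        nlinarith [norm_nonneg w.1]
    · exact ⟨w, ⟨heq, hn.trans heq⟩, rfl⟩
  · rintro ⟨w, ⟨hw1, hw2⟩, rfl⟩
    refine ⟨subset_closure ⟨w, ⟨hw1.le, hw2.le⟩, rfl⟩, fun hint => ?_⟩
    -- Enlarging `p` by the factor `1 + t` leaves `Γ`, where `|p| ≤ 1`.
    have hcont : Tendsto (fun t : ℝ => ((symmMap w).1, (1 + t : ℂ) * (symmMap w).2)) (𝓝[>] 0)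
        (𝓝 (symmMap w)) := by
      have : Continuous (fun t : ℝ => ((symmMap w).1, (1 + t : ℂ) * (symmMap w).2)) := by
        fun_prop
      simpa using (this.tendsto 0).mono_left nhdsWithin_le_nhds
    obtain ⟨t, ht, ht0⟩ := ((hcont.eventually (mem_interior_iff_mem_nhds.1 hint)).and
      self_mem_nhdsWithin).exists
    have h1 := norm_snd_le_of_mem ht
    have ht0 : 0 < t := ht0
    have h2 : ‖(1 + t : ℂ)‖ = 1 + t := by
      rw [← Complex.ofReal_one, ← Complex.ofReal_add, Complex.norm_real, Real.norm_of_nonneg]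
      linarith
    simp only [symmMap, norm_mul, h2, hw1, hw2] at h1
    linarith

/-! ### Polynomials in commuting elements of a Banach algebra -/

theorem aeval_eq_evalPt (p : MvPolynomial (Fin 2) ℂ) {B : Type*} [CommRing B] [Algebra ℂ B]
    (a b : B) (χ : B →ₐ[ℂ] ℂ) : χ (MvPolynomial.aeval ![a, b] p) = evalPt p (χ a, χ b) := by
  have h : (fun i => χ (![a, b] i)) = ![χ a, χ b] := by
    ext i
    fin_cases i <;> rfl
  rw [MvPolynomial.comp_aeval_apply, evalPt, ← MvPolynomial.coe_aeval_eq_eval, h]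
  rfl

/-- Gelfand theory for two elements of a commutative Banach algebra: each point of the spectrum
of `p(a, b)` is a value of `p` at a point of the joint spectrum. -/
theorem exists_evalPt_eq_of_mem_spectrum {B : Type*} [NormedCommRing B] [NormOneClass B]
    [NormedAlgebra ℂ B] [CompleteSpace B] (a b : B) (p : MvPolynomial (Fin 2) ℂ) {c : ℂ}
    (hc : c ∈ spectrum ℂ (MvPolynomial.aeval ![a, b] p)) :
    ∃ z, evalPt p z = c ∧ ∀ q, ‖evalPt q z‖ ≤ ‖MvPolynomial.aeval ![a, b] q‖ := by
  obtain ⟨χ, hχ⟩ := WeakDual.CharacterSpace.mem_spectrum_iff_exists.1 hc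
  let χ' : B →ₐ[ℂ] ℂ := WeakDual.CharacterSpace.toAlgHom χ
  refine ⟨(χ' a, χ' b), ?_, fun q => ?_⟩
  · rw [← aeval_eq_evalPt]; exact hχ
  · rw [← aeval_eq_evalPt]
    exact spectrum.norm_le_norm_of_mem (AlgHom.apply_mem_spectrum χ' _)

section CommutingPair

theorem Commute.forall_pair {B : Type*} [Ring B] {S P : B} (h : Commute S P) :
    ∀ a ∈ ({S, P} : Set B), ∀ b ∈ ({S, P} : Set B), a * b = b * a := by
  rintro a (rfl | rfl) b (rfl | rfl)
  exacts [rfl, h.eq, h.eq.symm, rfl]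

variable {B : Type*} [Ring B] [Algebra ℂ B]

/-- The unital subalgebra generated by a pair. -/
abbrev pairAlg (S P : B) : Subalgebra ℂ B := Algebra.adjoin ℂ {S, P}

theorem fst_mem_pairAlg (S P : B) : S ∈ pairAlg S P := Algebra.subset_adjoin (by simp)

theorem snd_mem_pairAlg (S P : B) : P ∈ pairAlg S P := Algebra.subset_adjoin (by simp)

theorem Commute.mul_comm_pairAlg {S P : B} (h : Commute S P) (x y : pairAlg S P) :
    x * y = y * x := by
  exact (Algebra.isMulCommutative_adjoin ℂ h.forall_pair).is_comm.comm x y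

/-- The algebra generated by a commuting pair is commutative. -/
abbrev Commute.pairCommRing {S P : B} (h : Commute S P) : CommRing (pairAlg S P) :=
  { (pairAlg S P).toRing with mul_comm := h.mul_comm_pairAlg }

end CommutingPair

section Operators

variable {H : Type*} [NormedAddCommGroup H] [InnerProductSpace ℂ H]

/-- A subalgebra containing a commuting pair gives the polynomial calculus of the pair. -/
theorem evalOp_eq_algHom_aeval {B : Type*} [CommRing B] [Algebra ℂ B]
    (φ : B →ₐ[ℂ] (H →L[ℂ] H)) (a b : B) (p : MvPolynomial (Fin 2) ℂ) :
    evalOp (φ a) (φ b) p = φ (MvPolynomial.aeval ![a, b] p) := by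
  rw [MvPolynomial.aeval_def, MvPolynomial.eval₂_eq', map_sum, evalOp]
  refine Finset.sum_congr rfl fun m _ => ?_
  rw [map_mul, AlgHom.commutes, Fin.prod_univ_two, map_mul, map_pow, map_pow,
    Algebra.smul_def]
  rfl

/-- The polynomial calculus `p ↦ p(S, P)` of a commuting pair. -/
def evalHom {S P : H →L[ℂ] H} (h : Commute S P) :
    MvPolynomial (Fin 2) ℂ →ₐ[ℂ] (H →L[ℂ] H) :=
  -- `MvPolynomial.aeval` requires a commutative target, hence the detour through the algebra of the
  -- pair.
  letI := h.pairCommRing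
  (pairAlg S P).val.comp (MvPolynomial.aeval
    ![(⟨S, fst_mem_pairAlg S P⟩ : pairAlg S P), ⟨P, snd_mem_pairAlg S P⟩])

theorem evalHom_apply {S P : H →L[ℂ] H} (h : Commute S P) (p : MvPolynomial (Fin 2) ℂ) :
    evalHom h p = evalOp S P p := by
  let := h.pairCommRing
  exact (evalOp_eq_algHom_aeval (B := pairAlg S P) (pairAlg S P).val ⟨S, fst_mem_pairAlg S P⟩
    ⟨P, snd_mem_pairAlg S P⟩ p).symm

@[simp] theorem evalHom_X_zero {S P : H →L[ℂ] H} (h : Commute S P) : evalHom h (.X 0) = S := by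
  let := h.pairCommRing
  change (pairAlg S P).val (MvPolynomial.aeval _ _) = S
  rw [MvPolynomial.aeval_X]
  rfl

@[simp] theorem evalHom_X_one {S P : H →L[ℂ] H} (h : Commute S P) : evalHom h (.X 1) = P := by
  let := h.pairCommRing
  change (pairAlg S P).val (MvPolynomial.aeval _ _) = P
  rw [MvPolynomial.aeval_X]
  rfl

theorem evalHom_mem_pairAlg {S P : H →L[ℂ] H} (h : Commute S P) (p : MvPolynomial (Fin 2) ℂ) :
    evalHom h p ∈ pairAlg S P := Subtype.property _

/-- Joint spectral mapping for commuting operators, in norm form. -/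
theorem exists_evalPt_eq_of_mem_spectrum_evalHom [CompleteSpace H] {S P : H →L[ℂ] H}
    (h : Commute S P) (p : MvPolynomial (Fin 2) ℂ) {c : ℂ} (hc : c ∈ spectrum ℂ (evalHom h p)) :
    ∃ z, evalPt p z = c ∧ ∀ q, ‖evalPt q z‖ ≤ ‖evalHom h q‖ := by
  -- On the zero space `NormOneClass` fails, but the spectrum is empty.
  rcases subsingleton_or_nontrivial H with hs | hn
  · have : Subsingleton (H →L[ℂ] H) := ⟨fun f g => by ext x; exact Subsingleton.elim _ _⟩
    rw [spectrum.of_subsingleton] at hc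
    exact hc.elim
  let A := (pairAlg S P).topologicalClosure
  let : NormedCommRing A :=
    { Subalgebra.normedRing A with
      mul_comm := (Subalgebra.commRingTopologicalClosure _ h.mul_comm_pairAlg).mul_comm }
  have : CompleteSpace A := (pairAlg S P).isClosed_topologicalClosure.completeSpace_coe
  have : NormOneClass A := ⟨norm_one (α := H →L[ℂ] H)⟩
  let a : A := ⟨S, (pairAlg S P).le_topologicalClosure (fst_mem_pairAlg S P)⟩
  let b : A := ⟨P, (pairAlg S P).le_topologicalClosure (snd_mem_pairAlg S P)⟩
  have key : ∀ q, evalHom h q = A.val (MvPolynomial.aeval ![a, b] q) := fun q =>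
    (evalHom_apply h q).trans (evalOp_eq_algHom_aeval A.val a b q)
  rw [key] at hc
  -- The spectrum may grow in the subalgebra `A`; this is harmless, as only the norm bounds on
  -- characters matter.
  obtain ⟨z, hz, hz'⟩ := exists_evalPt_eq_of_mem_spectrum a b p
    (AlgHom.spectrum_apply_subset A.val _ hc)
  refine ⟨z, hz, fun q => (hz' q).trans_eq ?_⟩
  rw [key]
  rfl

end Operators

/-! ### Rational functions on `Γ` as limits of polynomials -/

/-- A polynomial without zeros on `Γ` has an inverse that polynomials approximate uniformly. -/
theorem exists_norm_mul_sub_one_le {q : MvPolynomial (Fin 2) ℂ}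
    (hq : ∀ z ∈ closedSymmBidisc, evalPt q z ≠ 0) {ε : ℝ} (hε : 0 < ε) :
    ∃ g : MvPolynomial (Fin 2) ℂ, ∀ z ∈ closedSymmBidisc, ‖evalPt (g * q) z - 1‖ ≤ ε := by
  have : CompactSpace closedSymmBidisc := isCompact_iff_compactSpace.1 isCompact_closedSymmBidisc
  have : Nonempty closedSymmBidisc := ⟨⟨0, zero_mem_closedSymmBidisc⟩⟩
  let ev : MvPolynomial (Fin 2) ℂ →ₐ[ℂ] C(closedSymmBidisc, ℂ) :=
    MvPolynomial.aeval ![⟨fun z => z.1.1, by fun_prop⟩, ⟨fun z => z.1.2, by fun_prop⟩]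
  have hev : ∀ p z, ev p z = evalPt p z := fun p z =>
    aeval_eq_evalPt p _ _ (ContinuousMap.evalAlgHom ℂ ℂ z)
  -- In the uniform closure of the polynomials, every character is evaluation at a point satisfying
  -- the inequalities that cut out `Γ`. So no character kills `q`, and `q` is invertible there.
  let A := ev.range.topologicalClosure
  have hle : ev.range ≤ A := ev.range.le_topologicalClosure
  have : CompleteSpace A := ev.range.isClosed_topologicalClosure.completeSpace_coe
  have : NormOneClass A := ⟨norm_one (α := C(closedSymmBidisc, ℂ))⟩
  let a : A := ⟨ev (.X 0), hle ⟨_, rfl⟩⟩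
  let b : A := ⟨ev (.X 1), hle ⟨_, rfl⟩⟩
  have key : ∀ p, A.val (MvPolynomial.aeval ![a, b] p) = ev p := by
    intro p
    rw [MvPolynomial.comp_aeval_apply]
    change _ = MvPolynomial.aeval _ _
    congr 2
    ext i
    fin_cases i <;> simp [a, b, ev]
  have hunit : IsUnit (MvPolynomial.aeval ![a, b] q) := by
    by_contra hcon
    rw [← spectrum.zero_mem_iff ℂ] at hcon
    obtain ⟨z, hz, hz'⟩ := exists_evalPt_eq_of_mem_spectrum a b q hcon
    have hle : ∀ p C, (∀ z ∈ closedSymmBidisc, ‖evalPt p z‖ ≤ C) → ‖evalPt p z‖ ≤ C := by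
      intro p C hC
      refine (hz' p).trans ?_
      change ‖A.val (MvPolynomial.aeval ![a, b] p)‖ ≤ C
      rw [key, ContinuousMap.norm_le_of_nonempty]
      exact fun w => by rw [hev]; exact hC w w.2
    refine hq z (mem_closedSymmBidisc_of_forall
      (fun k => hle _ _ fun _ => norm_powerSumPoly_le_of_mem k) ?_) hz
    simpa [evalPt] using hle (.X 1) 1 fun w hw => by simpa [evalPt] using norm_snd_le_of_mem hw
  obtain ⟨r, hr⟩ := hunit.exists_left_inv
  have hqpos : 0 < ‖ev q‖ + 1 := by positivity
  -- With `r` the inverse of `q`, `g q - 1 = (g - r) q`; the tolerance absorbs `‖q‖`, and the `+ 1`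
  -- keeps the denominator positive.
  obtain ⟨_, ⟨g, rfl⟩, hg⟩ := Metric.mem_closure_iff.1 r.2 (ε / (‖ev q‖ + 1)) (by positivity)
  refine ⟨g, fun z hz => ?_⟩
  have hr' : (r : C(closedSymmBidisc, ℂ)) * ev q = 1 := by
    rw [← key q]; exact congrArg A.val hr
  have h1 : evalPt (g * q) z - 1 = ((ev g - r) * ev q) ⟨z, hz⟩ := by
    rw [sub_mul, hr', ← map_mul]
    simp [hev, evalPt]
  rw [h1]
  refine (ContinuousMap.norm_coe_le_norm _ _).trans ((norm_mul_le _ _).trans ?_)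
  rw [dist_comm, dist_eq_norm, lt_div_iff₀ hqpos] at hg
  refine le_trans ?_ hg.le
  exact mul_le_mul_of_nonneg_left (by linarith) (norm_nonneg _)

section SpectralSet

variable {H : Type*} [NormedAddCommGroup H] [InnerProductSpace ℂ H]

/-- The maps `(x, y) ↦ C x + D y` and `x ↦ (-D x, C x)` are a contracting homotopy of the Koszul
complex. -/
theorem Commute.koszulExact_of_mul_add_mul_eq_one {S P C D : H →L[ℂ] H} (h : Commute S P)
    (hCS : Commute C S) (hCP : Commute C P) (hDS : Commute D S) (hDP : Commute D P)
    (h1 : C * S + D * P = 1) : KoszulExact S P := by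
  have one (x : H) : C (S x) + D (P x) = x := congrArg (fun f : H →L[ℂ] H => f x) h1
  have ev {F G : H →L[ℂ] H} (hc : Commute F G) (x : H) : F (G x) = G (F x) :=
    congrArg (fun f : H →L[ℂ] H => f x) hc.eq
  refine ⟨?_, ?_, ?_⟩
  · intro x y hxy
    have hS : S x = S y := congrArg Prod.fst hxy
    have hP : P x = P y := congrArg Prod.snd hxy
    rw [← one x, ← one y, hS, hP]
  · rintro ⟨x, y⟩
    constructor
    · intro hxy
      have hxy : S y = P x := sub_eq_zero.1 hxy
      refine ⟨C x + D y, Prod.ext ?_ ?_⟩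
      · change S (C x + D y) = x
        rw [map_add, ← ev hCS, ← ev hDS, hxy, one]
      · change P (C x + D y) = y
        rw [map_add, ← ev hCP, ← ev hDP, ← hxy, one]
    · rintro ⟨u, hu⟩
      rw [← hu]
      change S (P u) - P (S u) = 0
      rw [ev h, sub_self]
  · intro x
    refine ⟨(-(D x), C x), ?_⟩
    change S (C x) - P (-(D x)) = x
    rw [map_neg, sub_neg_eq_add, ← ev hCS, ← ev hDP, one]

/-- Every polynomial is, modulo the ideal of the point, its value there. -/
theorem exists_eq_add_mul_add_mul (p : MvPolynomial (Fin 2) ℂ) (z : ℂ × ℂ) :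
    ∃ g₁ g₂, p = .C (evalPt p z) + g₁ * (.X 0 - .C z.1) + g₂ * (.X 1 - .C z.2) := by
  induction p using MvPolynomial.induction_on with
  | C a => exact ⟨0, 0, by simp [evalPt]⟩
  | add p q hp hq =>
    obtain ⟨a, b, h⟩ := hp
    obtain ⟨c, d, h'⟩ := hq
    have e : evalPt (p + q) z = evalPt p z + evalPt q z := by simp [evalPt]
    refine ⟨a + c, b + d, ?_⟩
    rw [e, map_add]
    linear_combination h + h'
  | mul_X p i hp =>
    obtain ⟨a, b, h⟩ := hp
    fin_cases i
    · have e : evalPt (p * .X 0) z = evalPt p z * z.1 := by simp [evalPt]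
      refine ⟨a * .X 0 + .C (evalPt p z), b * .X 0, ?_⟩
      simp only [Fin.zero_eta]
      rw [e, map_mul]
      linear_combination .X 0 * h
    · have e : evalPt (p * .X 1) z = evalPt p z * z.2 := by simp [evalPt]
      refine ⟨a * .X 1, b * .X 1 + .C (evalPt p z), ?_⟩
      simp only [Fin.mk_one]
      rw [e, map_mul]
      linear_combination .X 1 * h

theorem exists_gammaSupNorm_lt_of_notMem {z : ℂ × ℂ} (hz : z ∉ closedSymmBidisc) :
    ∃ p, gammaSupNorm p 1 < ‖evalPt p z‖ := by
  by_contra! hcon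
  refine hz (mem_closedSymmBidisc_of_forall (fun k => (hcon _).trans
    (gammaSupNorm_one_le fun _ => norm_powerSumPoly_le_of_mem k)) ?_)
  simpa [evalPt] using (hcon (.X 1)).trans (gammaSupNorm_one_le (C := 1) fun w hw => by
    simpa [evalPt] using norm_snd_le_of_mem hw)

/-- A commuting pair that satisfies von Neumann's inequality on `Γ` for polynomials is a
`Γ`-contraction. -/
theorem Commute.isGammaContraction [CompleteSpace H] {S P : H →L[ℂ] H} (h : Commute S P)
    (hvN : ∀ p, ‖evalHom h p‖ ≤ gammaSupNorm p 1) : IsGammaContraction S P := by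
  have hunit : ∀ q : MvPolynomial (Fin 2) ℂ, (∀ z ∈ closedSymmBidisc, evalPt q z ≠ 0) →
      IsUnit (evalHom h q) := by
    intro q hq
    -- Any tolerance below `1` makes `(g q)(S, P)` invertible by a Neumann series, and then so is
    -- its commuting factor `q(S, P)`.
    obtain ⟨g, hg⟩ := exists_norm_mul_sub_one_le hq (ε := 1 / 2) (by norm_num)
    have h1 : ‖evalHom h (1 - g * q)‖ < 1 := by
      refine (hvN _).trans_lt ((gammaSupNorm_one_le (C := 1 / 2) fun z hz => ?_).trans_lt
        (by norm_num))
      rw [← norm_neg]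
      simpa [evalPt] using hg z hz
    have h2 := isUnit_one_sub_of_norm_lt_one h1
    rw [map_sub, map_one, sub_sub_cancel, map_mul] at h2
    have hc : Commute (evalHom h g) (evalHom h q) := by
      rw [Commute, SemiconjBy, ← map_mul, mul_comm, map_mul]
    exact (hc.isUnit_mul_iff.1 h2).2
  refine ⟨h, fun z hz => ?_, fun p q hq => ?_⟩
  · by_contra hzΓ
    obtain ⟨p, hp⟩ := exists_gammaSupNorm_lt_of_notMem hzΓ
    obtain ⟨g₁, g₂, hg⟩ := exists_eq_add_mul_add_mul p z
    -- Since `|p| < |p(z)|` on `Γ`, the polynomial `p(z) - p` is zero-free there. It lies in the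
    -- ideal of the point `z`, so inverting its operator value writes `1` as a combination of `S -
    -- z.1` and `P - z.2`.
    have hu := hunit (.C (evalPt p z) - p) fun w hw h0 => by
      have : evalPt p w = evalPt p z := by
        simp only [evalPt, map_sub, MvPolynomial.eval_C] at h0 ⊢
        exact (sub_eq_zero.1 h0).symm
      exact absurd (norm_evalPt_le_gammaSupNorm p hw) (by rw [this]; exact not_le.2 hp)
    have e : (.C (evalPt p z) - p : MvPolynomial (Fin 2) ℂ) =
        (-g₁) * (.X 0 - .C z.1) + (-g₂) * (.X 1 - .C z.2) := by
      linear_combination -hg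
    have hC : ∀ c : ℂ, evalHom h (.C c) = c • 1 := fun c => by
      rw [← MvPolynomial.algebraMap_eq, AlgHom.commutes, Algebra.algebraMap_eq_smul_one]
    have hcomm : ∀ p q, Commute (evalHom h p) (evalHom h q) := fun p q => by
      rw [Commute, SemiconjBy, ← map_mul, mul_comm, map_mul]
    have hS : S - z.1 • 1 = evalHom h (.X 0 - .C z.1) := by simp [hC]
    have hP : P - z.2 • 1 = evalHom h (.X 1 - .C z.2) := by simp [hC]
    obtain ⟨u, hu'⟩ := hu
    have hinv : ∀ q, Commute (↑u⁻¹ : H →L[ℂ] H) (evalHom h q) := fun q => by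
      refine Commute.units_inv_left ?_
      rw [hu']; exact hcomm _ _
    refine hz ?_
    rw [hS, hP]
    refine (hcomm _ _).koszulExact_of_mul_add_mul_eq_one (C := ↑u⁻¹ * evalHom h (-g₁))
      (D := ↑u⁻¹ * evalHom h (-g₂)) ((hinv _).mul_left (hcomm _ _))
      ((hinv _).mul_left (hcomm _ _)) ((hinv _).mul_left (hcomm _ _))
      ((hinv _).mul_left (hcomm _ _)) ?_
    rw [mul_assoc, mul_assoc, ← mul_add, ← map_mul, ← map_mul, ← map_add, ← e, ← hu',
      Units.inv_mul]
  · rw [← evalHom_apply h, ← evalHom_apply h]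
    refine ⟨hunit q hq, ?_⟩
    set r := Ring.inverse (evalHom h q)
    have hr : evalHom h q * r = 1 := Ring.mul_inverse_cancel _ (hunit q hq)
    refine le_of_forall_pos_le_add fun δ hδ => ?_
    set M := gammaSupNorm p q + ‖evalHom h p * r‖
    have hM : 0 ≤ M := add_nonneg (gammaSupNorm_nonneg _ _) (norm_nonneg _)
    obtain ⟨g, hg⟩ := exists_norm_mul_sub_one_le hq (ε := δ / (M + 1)) (by positivity)
    -- Replacing `1 / q` by `g` costs the error `(p / q)(1 - g q)`, both on `Γ` and for operators;
    -- `M` adds up the two coefficients of that error.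
    have e : evalHom h p * r = evalHom h (p * g) + evalHom h p * r * evalHom h (1 - g * q) := by
      have hc : r * evalHom h (g * q) = evalHom h g := by
        have hqr : r * evalHom h q = 1 := Ring.inverse_mul_cancel _ (hunit q hq)
        rw [mul_comm g, map_mul, ← mul_assoc, hqr, one_mul]
      rw [map_sub, map_one, mul_sub, mul_one, mul_assoc, hc, map_mul]
      abel
    have b1 : ‖evalHom h (p * g)‖ ≤ gammaSupNorm p q + gammaSupNorm p q * (δ / (M + 1)) := by
      refine (hvN _).trans (gammaSupNorm_one_le fun z hz => ?_)
      have hpq := norm_le_gammaSupNorm (p := p) hq hz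
      have : evalPt (p * g) z = evalPt p z / evalPt q z +
          evalPt p z / evalPt q z * (evalPt (g * q) z - 1) := by
        have := hq z hz
        simp only [evalPt, map_mul] at this ⊢
        field_simp
        ring
      rw [this]
      refine (norm_add_le _ _).trans (add_le_add hpq ?_)
      rw [norm_mul]
      exact mul_le_mul hpq (hg z hz) (norm_nonneg _) (gammaSupNorm_nonneg _ _)
    have b2 : ‖evalHom h (1 - g * q)‖ ≤ δ / (M + 1) := by
      refine (hvN _).trans (gammaSupNorm_one_le fun z hz => ?_)
      rw [← norm_neg]
      simpa [evalPt] using hg z hz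
    calc ‖evalHom h p * r‖ ≤ ‖evalHom h (p * g)‖ + ‖evalHom h p * r‖ * ‖evalHom h (1 - g * q)‖ := by
          conv_lhs => rw [e]
          exact (norm_add_le _ _).trans (add_le_add_right (norm_mul_le _ _) _)
      _ ≤ gammaSupNorm p q + gammaSupNorm p q * (δ / (M + 1)) +
          ‖evalHom h p * r‖ * (δ / (M + 1)) :=
        add_le_add b1 (mul_le_mul_of_nonneg_left b2 (norm_nonneg _))
      _ = gammaSupNorm p q + M * (δ / (M + 1)) := by ring
      _ ≤ gammaSupNorm p q + δ := by
        gcongr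
        rw [← mul_div_assoc, div_le_iff₀ (by positivity)]
        nlinarith

theorem IsGammaContraction.norm_evalHom_le {S P : H →L[ℂ] H} (h : IsGammaContraction S P)
    (p : MvPolynomial (Fin 2) ℂ) : ‖evalHom h.commute p‖ ≤ gammaSupNorm p 1 := by
  have h1 : evalOp S P 1 = 1 := by rw [← evalHom_apply h.commute, map_one]
  have := (h.vonNeumann p 1 evalPt_one_ne_zero).2
  rwa [h1, Ring.inverse_one, mul_one, ← evalHom_apply h.commute] at this

theorem IsGammaContraction.norm_fst_le {S P : H →L[ℂ] H} (h : IsGammaContraction S P) :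
    ‖S‖ ≤ 2 := by
  simpa using (h.norm_evalHom_le (.X 0)).trans (gammaSupNorm_one_le (C := 2) fun w hw => by
    simpa [evalPt] using norm_fst_le_of_mem hw)

theorem IsGammaContraction.norm_snd_le {S P : H →L[ℂ] H} (h : IsGammaContraction S P) :
    ‖P‖ ≤ 1 := by
  simpa using (h.norm_evalHom_le (.X 1)).trans (gammaSupNorm_one_le (C := 1) fun w hw => by
    simpa [evalPt] using norm_snd_le_of_mem hw)

end SpectralSet

/-! ### Commuting pairs `(T, V)` with `V` isometric and `T = T* V` -/

section GammaIsometry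

variable {K : Type*} [NormedAddCommGroup K] [InnerProductSpace ℂ K]

/-- A commuting pair `(T, V)` with `V` isometric and `T = T* V`. -/
structure IsToeplitzPair (T V : K →L[ℂ] K) : Prop where
  commute : Commute T V
  norm_map : ∀ x, ‖V x‖ = ‖x‖
  inner_map : ∀ x y, inner ℂ (T x) y = inner ℂ (V x) (T y)

variable {T V : K →L[ℂ] K}

theorem IsToeplitzPair.inner_map_map (h : IsToeplitzPair T V) (x y : K) :
    inner ℂ (V x) (V y) = inner ℂ x y :=
  (LinearMap.norm_map_iff_inner_map_map V).1 h.norm_map x y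

theorem IsToeplitzPair.inner_pow_map_pow_map (h : IsToeplitzPair T V) (n : ℕ) (x y : K) :
    inner ℂ ((V ^ n) x) ((V ^ n) y) = inner ℂ x y := by
  induction n with
  | zero => simp
  | succ n ih =>
    rw [pow_succ']
    exact (h.inner_map_map _ _).trans ih

theorem IsToeplitzPair.norm_pow_map (h : IsToeplitzPair T V) (n : ℕ) (x : K) :
    ‖(V ^ n) x‖ = ‖x‖ := by
  rw [@norm_eq_sqrt_re_inner ℂ, @norm_eq_sqrt_re_inner ℂ, h.inner_pow_map_pow_map]

theorem IsToeplitzPair.norm_snd_le (h : IsToeplitzPair T V) : ‖V‖ ≤ 1 :=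
  V.opNorm_le_bound zero_le_one fun x => by rw [h.norm_map, one_mul]

theorem commute_apply {a b : K →L[ℂ] K} (h : Commute a b) (x : K) : a (b x) = b (a x) :=
  congrArg (fun f : K →L[ℂ] K => f x) h.eq

theorem mul_comm_of_mem_pairAlg (h : Commute T V) {a b : K →L[ℂ] K} (ha : a ∈ pairAlg T V)
    (hb : b ∈ pairAlg T V) : Commute a b :=
  congrArg Subtype.val (h.mul_comm_pairAlg ⟨a, ha⟩ ⟨b, hb⟩)

/-- Every operator `a` in the algebra of the pair satisfies `a = b* V ^ m` for some `b` in the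
algebra and some `m`. -/
theorem IsToeplitzPair.exists_inner_eq (h : IsToeplitzPair T V) {a : K →L[ℂ] K}
    (ha : a ∈ pairAlg T V) :
    ∃ b ∈ pairAlg T V, ∃ m : ℕ, ∀ x y, inner ℂ (a x) y = inner ℂ ((V ^ m) x) (b y) := by
  have hV := snd_mem_pairAlg T V
  -- The isometry `V ^ k` may be inserted on both sides of the inner product; this brings two
  -- summands to a common exponent.
  have lift : ∀ {a b : K →L[ℂ] K} {m : ℕ} (k : ℕ), b ∈ pairAlg T V →
      (∀ x y, inner ℂ (a x) y = inner ℂ ((V ^ m) x) (b y)) →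
      ∀ x y, inner ℂ (a x) y = inner ℂ ((V ^ (k + m)) x) ((V ^ k * b) y) := by
    intro a b m k _ hab x y
    rw [hab, pow_add]
    exact (h.inner_pow_map_pow_map k _ _).symm
  induction ha using Algebra.adjoin_induction with
  | mem x hx =>
    rcases hx with rfl | rfl
    · exact ⟨x, fst_mem_pairAlg _ _, 1, fun u v => by rw [pow_one]; exact h.inner_map u v⟩
    · exact ⟨1, one_mem _, 1, fun u v => by simp⟩
  | algebraMap c =>
    refine ⟨algebraMap ℂ _ (starRingEnd ℂ c), Subalgebra.algebraMap_mem _ _, 0, fun u v => ?_⟩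
    simp [Algebra.algebraMap_eq_smul_one, mul_comm]
  | add a a' _ _ iha iha' =>
    obtain ⟨b, hb, m, hab⟩ := iha
    obtain ⟨b', hb', m', hab'⟩ := iha'
    refine ⟨V ^ m' * b + V ^ m * b', add_mem (mul_mem (pow_mem hV _) hb)
      (mul_mem (pow_mem hV _) hb'), m' + m, fun x y => ?_⟩
    rw [add_apply, add_apply, inner_add_left,
      inner_add_right, ← lift m' hb hab]
    congr 1
    rw [add_comm, ← lift m hb' hab']
  | mul a a' _ ha' iha iha' =>
    obtain ⟨b, hb, m, hab⟩ := iha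
    obtain ⟨b', hb', m', hab'⟩ := iha'
    refine ⟨b' * b, mul_mem hb' hb, m' + m, fun x y => ?_⟩
    have hc : Commute a' (V ^ m) := (mul_comm_of_mem_pairAlg h.commute ha' (pow_mem hV _))
    rw [mul_apply_eq_comp, hab, ← commute_apply hc, hab', pow_add]
    rfl

/-- Operators in the algebra of the pair are paranormal. -/
theorem IsToeplitzPair.norm_sq_le (h : IsToeplitzPair T V) {a : K →L[ℂ] K}
    (ha : a ∈ pairAlg T V) : ‖a‖ ^ 2 ≤ ‖a ^ 2‖ := by
  obtain ⟨b, hb, m, hab⟩ := h.exists_inner_eq ha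
  have hV := snd_mem_pairAlg T V
  have hcab := mul_comm_of_mem_pairAlg h.commute ha hb
  have hcb := mul_comm_of_mem_pairAlg h.commute hb (pow_mem hV m)
  -- Use `a = b* V ^ m` twice, commute, and cancel the isometry `V ^ m`.
  have hnorm : ∀ y, ‖a y‖ = ‖b y‖ := by
    intro y
    have e : inner ℂ (b y) (b y) = inner ℂ (a y) (a y) := by
      rw [hab y (a y), ← commute_apply hcab, ← inner_conj_symm ((V ^ m) y), hab (b y),
        commute_apply hcb, h.inner_pow_map_pow_map, inner_conj_symm]
    rw [@norm_eq_sqrt_re_inner ℂ, @norm_eq_sqrt_re_inner ℂ _ _ _ _ (b y), e]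
  -- `‖a x‖² = ⟨V ^ m x, b a x⟩ ≤ ‖x‖ ‖b a x‖ = ‖x‖ ‖a² x‖`.
  have key : ∀ x, ‖a x‖ ^ 2 ≤ ‖a ^ 2‖ * ‖x‖ ^ 2 := by
    intro x
    have e : ‖a x‖ ^ 2 = ‖inner ℂ ((V ^ m) x) (b (a x))‖ := by
      rw [← hab, inner_self_eq_norm_sq_to_K]
      simp
    rw [e]
    refine (norm_inner_le_norm _ _).trans ?_
    rw [h.norm_pow_map, ← hnorm]
    have := (a ^ 2).le_opNorm x
    rw [pow_two, mul_apply_eq_comp] at this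
    rw [← pow_two] at this
    nlinarith [norm_nonneg x]
  have h2 : ‖a‖ ≤ √‖a ^ 2‖ := by
    refine a.opNorm_le_bound (Real.sqrt_nonneg _) fun x => ?_
    refine le_of_sq_le_sq ?_ (by positivity)
    rw [mul_pow, Real.sq_sqrt (norm_nonneg _)]
    exact key x
  calc ‖a‖ ^ 2 ≤ √‖a ^ 2‖ ^ 2 := pow_le_pow_left₀ (norm_nonneg _) h2 2
    _ = ‖a ^ 2‖ := Real.sq_sqrt (norm_nonneg _)

theorem IsToeplitzPair.norm_pow_two_pow (h : IsToeplitzPair T V) {a : K →L[ℂ] K}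
    (ha : a ∈ pairAlg T V) (k : ℕ) : ‖a‖ ^ 2 ^ k ≤ ‖a ^ 2 ^ k‖ := by
  induction k with
  | zero => simp
  | succ k ih =>
    rw [pow_succ, pow_mul, pow_mul]
    exact (pow_le_pow_left₀ (by positivity) ih 2).trans (h.norm_sq_le (pow_mem ha _))

/-- Gelfand's formula along the exponents `2 ^ k`, where `‖a‖ ^ 2 ^ k ≤ ‖a ^ 2 ^ k‖`, bounds `‖a‖`
by the spectral radius. -/
theorem IsToeplitzPair.norm_le_of_spectrum [CompleteSpace K] (h : IsToeplitzPair T V)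
    {a : K →L[ℂ] K} (ha : a ∈ pairAlg T V) {C : ℝ} (hC : ∀ c ∈ spectrum ℂ a, ‖c‖ ≤ C)
    (hC0 : 0 ≤ C) : ‖a‖ ≤ C := by
  have h1 : Tendsto (fun k : ℕ => ENNReal.ofReal (‖a ^ 2 ^ k‖ ^ (1 / (2 ^ k : ℕ) : ℝ))) atTop
      (𝓝 (spectralRadius ℂ a)) :=
    (spectrum.pow_norm_pow_one_div_tendsto_nhds_spectralRadius a).comp
      (tendsto_pow_atTop_atTop_of_one_lt (r := (2 : ℕ)) one_lt_two)
  have h2 : ENNReal.ofReal ‖a‖ ≤ spectralRadius ℂ a := by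
    refine ge_of_tendsto' h1 fun k => ENNReal.ofReal_le_ofReal ?_
    have := Real.rpow_le_rpow (by positivity) (h.norm_pow_two_pow ha k)
      (z := 1 / (2 ^ k : ℕ)) (by positivity)
    rwa [one_div, Real.pow_rpow_inv_natCast (norm_nonneg _) (by positivity), ← one_div] at this
  have h3 : spectralRadius ℂ a ≤ ENNReal.ofReal C := by
    refine iSup₂_le fun c hc => ?_
    change ‖c‖ₑ ≤ _
    rw [← ofReal_norm]
    exact ENNReal.ofReal_le_ofReal (hC c hc)
  exact (ENNReal.ofReal_le_ofReal_iff hC0).1 (h2.trans h3)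

/-- The growth of powers bounds the norm, as the operators in the algebra are normaloid. -/
theorem IsToeplitzPair.norm_le_of_norm_pow_le (h : IsToeplitzPair T V)
    {a : K →L[ℂ] K} (ha : a ∈ pairAlg T V) {r C : ℝ} (hr : 0 < r)
    (hC : ∀ k : ℕ, ‖a ^ k‖ ≤ C * (k + 1) * r ^ k) : ‖a‖ ≤ r := by
  by_contra! hlt
  have hq : 1 < ‖a‖ / r := (one_lt_div hr).2 hlt
  -- Were `‖a‖ > r`, the factor `(‖a‖ / r) ^ n` would outgrow `C (n + 1)`; the contradiction is read
  -- off at some `n = 2 ^ k`.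
  have hlim : Tendsto (fun n : ℕ => (C * (n + 1)) / (‖a‖ / r) ^ n) atTop (𝓝 0) := by
    have h1 := (tendsto_pow_const_div_const_pow_of_one_lt 1 hq).const_mul C
    have h0 := (tendsto_pow_const_div_const_pow_of_one_lt 0 hq).const_mul C
    convert h1.add h0 using 2 with n
    · ring
    · simp
  have hev := (hlim.comp (tendsto_pow_atTop_atTop_of_one_lt (r := (2 : ℕ)) one_lt_two)).eventually
    (gt_mem_nhds one_pos)
  obtain ⟨k, hk⟩ := hev.exists
  have h1 := (h.norm_pow_two_pow ha k).trans (hC (2 ^ k))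
  simp only [Function.comp] at hk
  rw [div_lt_one (by positivity), div_pow, lt_div_iff₀ (by positivity)] at hk
  push_cast at hk h1
  linarith

/-- `0 ≤ T* T ≤ 4`, so the Rayleigh quotients of the self-adjoint `T* T - 2` lie in `[-2, 2]`. -/
theorem norm_adjoint_mul_self_sub_two_le [CompleteSpace K] (hT : ‖T‖ ≤ 2) :
    ‖ContinuousLinearMap.adjoint T * T - 2‖ ≤ 2 := by
  have hsymm : (ContinuousLinearMap.adjoint T * T - 2).IsSymmetric := by
    rw [← ContinuousLinearMap.isSelfAdjoint_iff_isSymmetric]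
    refine (IsSelfAdjoint.star_mul_self T).sub ?_
    exact (IsSelfAdjoint.one (K →L[ℂ] K)).add (IsSelfAdjoint.one _) |> fun h => by
      rwa [one_add_one_eq_two] at h
  rw [ContinuousLinearMap.norm_eq_iSup_rayleighQuotient _ hsymm]
  refine ciSup_le fun x => ?_
  rw [ContinuousLinearMap.rayleighQuotient, ContinuousLinearMap.reApplyInnerSelf_apply]
  rcases eq_or_ne x 0 with rfl | hx
  · simp
  have e : RCLike.re (inner ℂ ((ContinuousLinearMap.adjoint T * T - 2) x) x) =
      ‖T x‖ ^ 2 - 2 * ‖x‖ ^ 2 := by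
    have : (ContinuousLinearMap.adjoint T * T - 2) x =
        ContinuousLinearMap.adjoint T (T x) - (2 : ℂ) • x := by
      rw [two_smul]; rw [← one_add_one_eq_two]; rfl
    rw [this, inner_sub_left, ContinuousLinearMap.adjoint_inner_left, inner_smul_left, map_sub,
      inner_self_eq_norm_sq, map_ofNat]
    have h2 : RCLike.re (2 * inner ℂ x x) = 2 * ‖x‖ ^ 2 := by
      rw [← inner_self_eq_norm_sq (𝕜 := ℂ) x]; simp
    rw [h2]
  have hb : ‖T x‖ ^ 2 ≤ 4 * ‖x‖ ^ 2 := by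
    have := T.le_of_opNorm_le hT x
    calc ‖T x‖ ^ 2 ≤ (2 * ‖x‖) ^ 2 := pow_le_pow_left₀ (norm_nonneg _) this 2
      _ = _ := by ring
  have hpos : 0 < ‖x‖ ^ 2 := by positivity
  rw [e, abs_div, abs_of_pos hpos, div_le_iff₀ hpos, abs_le]
  constructor <;> nlinarith [sq_nonneg ‖T x‖]

/-- This is `(z₁, z₂) ↦ (z₁², z₂²)` in symmetric coordinates. The bound persists because `T* T V =
T* V T = T²`, whence `T² - 2V = (T* T - 2) V`. -/
theorem IsToeplitzPair.sq_sub [CompleteSpace K] (h : IsToeplitzPair T V) (hT : ‖T‖ ≤ 2) :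
    IsToeplitzPair (T ^ 2 - 2 * V) (V ^ 2) ∧ ‖T ^ 2 - 2 * V‖ ≤ 2 := by
  have h2 : ∀ x : K, (2 : K →L[ℂ] K) x = (2 : ℂ) • x := fun x => by
    rw [two_smul, ← one_add_one_eq_two]; rfl
  have hadj : ContinuousLinearMap.adjoint T * V = T := by
    refine ContinuousLinearMap.ext fun x => ext_inner_right ℂ fun y => ?_
    rw [mul_apply_eq_comp, ContinuousLinearMap.adjoint_inner_left]
    exact (h.inner_map x y).symm
  have hcT : ∀ x, T (V x) = V (T x) := commute_apply h.commute
  have happ : ∀ x, (T ^ 2 - 2 * V : K →L[ℂ] K) x = T (T x) - (2 : ℂ) • V x := fun x => by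
    rw [sub_apply, mul_apply_eq_comp, h2, pow_two]; rfl
  refine ⟨⟨?_, h.norm_pow_map 2, fun x y => ?_⟩, ?_⟩
  · refine (Commute.sub_left ?_ ?_).pow_right 2
    · exact h.commute.pow_left 2
    · exact (Commute.ofNat_left 2 V).mul_left (Commute.refl V)
  · rw [happ, happ, pow_two, mul_apply_eq_comp, inner_sub_left, inner_sub_right,
      h.inner_map (T x) y, ← hcT, h.inner_map (V x) (T y), inner_smul_left, inner_smul_right,
      h.inner_map_map (V x) y, Complex.conj_ofNat]
  · have e : T ^ 2 - 2 * V = (ContinuousLinearMap.adjoint T * T - 2) * V := by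
      rw [sub_mul, mul_assoc, h.commute.eq, ← mul_assoc, hadj, pow_two]
    rw [e]
    refine (norm_mul_le _ _).trans ?_
    calc _ ≤ (2 : ℝ) * 1 := mul_le_mul (norm_adjoint_mul_self_sub_two_le hT) h.norm_snd_le
          (norm_nonneg _) zero_le_two
      _ = 2 := mul_one _

theorem IsToeplitzPair.norm_powerSumPoly_le [CompleteSpace K] (h : IsToeplitzPair T V)
    (hT : ‖T‖ ≤ 2) (k : ℕ) : IsToeplitzPair (evalHom h.commute (powerSumPoly k)) (V ^ 2 ^ k) ∧
      ‖evalHom h.commute (powerSumPoly k)‖ ≤ 2 := by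
  induction k with
  | zero => simpa [powerSumPoly] using ⟨h, hT⟩
  | succ k ih =>
    have := ih.1.sq_sub ih.2
    have e : evalHom h.commute (powerSumPoly (k + 1)) =
        evalHom h.commute (powerSumPoly k) ^ 2 - 2 * V ^ 2 ^ k := by
      rw [powerSumPoly, map_sub, map_mul, map_pow, map_pow, map_ofNat, evalHom_X_one]
    rw [e, pow_succ 2 k, pow_mul]
    exact this

/-- Von Neumann's inequality on `Γ` for the pair `(T, V)`. -/
theorem IsToeplitzPair.norm_evalHom_le [CompleteSpace K] (h : IsToeplitzPair T V)
    (hT : ‖T‖ ≤ 2) (p : MvPolynomial (Fin 2) ℂ) : ‖evalHom h.commute p‖ ≤ gammaSupNorm p 1 := by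
  refine h.norm_le_of_spectrum (evalHom_mem_pairAlg _ _) (fun c hc => ?_) (gammaSupNorm_nonneg _ _)
  obtain ⟨z, rfl, hz⟩ := exists_evalPt_eq_of_mem_spectrum_evalHom h.commute p hc
  refine norm_evalPt_le_gammaSupNorm p (mem_closedSymmBidisc_of_forall
    (fun k => (hz _).trans (h.norm_powerSumPoly_le hT k).2) ?_)
  have := (hz (.X 1)).trans_eq (by rw [evalHom_X_one])
  simpa [evalPt] using this.trans h.norm_snd_le

end GammaIsometry

/-! ### Compression to a coinvariant subspace, extended by zero -/

section Compression

variable {K : Type*} [NormedAddCommGroup K] [InnerProductSpace ℂ K] {T V Q : K →L[ℂ] K}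

/-- `Q X = Q X Q` says that `X` preserves the kernel of `Q`, which makes compression by `Q`
multiplicative. -/
theorem commute_compression (h : Commute T V) (hT : Q * T = Q * T * Q)
    (hV : Q * V = Q * V * Q) : Commute (Q * T) (Q * V) := by
  rw [Commute, SemiconjBy, ← mul_assoc, ← hT, ← mul_assoc, ← hV, mul_assoc, mul_assoc, h.eq]

theorem compression_mul_evalHom (h : Commute T V) (hQ : Q * Q = Q) (hT : Q * T = Q * T * Q)
    (hV : Q * V = Q * V * Q) (p : MvPolynomial (Fin 2) ℂ) :
    Q * evalHom h p = Q * evalHom h p * Q := by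
  have hC : ∀ c : ℂ, evalHom h (.C c) = algebraMap ℂ _ c := fun c => by
    rw [← MvPolynomial.algebraMap_eq, AlgHom.commutes]
  induction p using MvPolynomial.induction_on with
  | C a => rw [hC, mul_assoc, Algebra.commutes, ← mul_assoc, hQ]
  | add p q hp hq => rw [map_add, mul_add, add_mul, ← hp, ← hq]
  | mul_X p i hp =>
    have hX : Q * evalHom h (.X i) = Q * evalHom h (.X i) * Q := by
      fin_cases i
      · simpa using hT
      · simpa using hV
    rw [map_mul, ← mul_assoc, hp, mul_assoc _ Q, hX]
    simp only [mul_assoc, hQ]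

theorem mul_evalHom_compression (h : Commute T V) (hQ : Q * Q = Q) (hT : Q * T = Q * T * Q)
    (hV : Q * V = Q * V * Q) (p : MvPolynomial (Fin 2) ℂ) :
    Q * evalHom (commute_compression h hT hV) p = Q * evalHom h p := by
  have hC : ∀ c : ℂ, evalHom h (.C c) = algebraMap ℂ _ c := fun c => by
    rw [← MvPolynomial.algebraMap_eq, AlgHom.commutes]
  have hC' : ∀ c : ℂ, evalHom (commute_compression h hT hV) (.C c) = algebraMap ℂ _ c :=
    fun c => by rw [← MvPolynomial.algebraMap_eq, AlgHom.commutes]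
  induction p using MvPolynomial.induction_on with
  | C a => rw [hC, hC']
  | add p q hp hq => rw [map_add, map_add, mul_add, mul_add, hp, hq]
  | mul_X p i hp =>
    have hX : evalHom (commute_compression h hT hV) (.X i) = Q * evalHom h (.X i) := by
      fin_cases i <;> simp
    rw [map_mul, map_mul, hX, ← mul_assoc, hp, ← mul_assoc,
      ← compression_mul_evalHom h hQ hT hV, mul_assoc]

/-- On the kernel of `Q` the compressed pair is `(0, 0)`, so only the constant term of `p` survives.
-/
theorem one_sub_mul_evalHom_compression (h : Commute T V) (hQ : Q * Q = Q)
    (hT : Q * T = Q * T * Q) (hV : Q * V = Q * V * Q) (p : MvPolynomial (Fin 2) ℂ) :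
    (1 - Q) * evalHom (commute_compression h hT hV) p = evalPt p 0 • (1 - Q) := by
  have hC' : ∀ c : ℂ, evalHom (commute_compression h hT hV) (.C c) = algebraMap ℂ _ c :=
    fun c => by rw [← MvPolynomial.algebraMap_eq, AlgHom.commutes]
  induction p using MvPolynomial.induction_on with
  | C a => rw [hC', ← Algebra.commutes, Algebra.smul_def]; simp [evalPt]
  | add p q hp hq =>
    have e : evalPt (p + q) 0 = evalPt p 0 + evalPt q 0 := by simp [evalPt]
    rw [map_add, mul_add, hp, hq, e, add_smul]
  | mul_X p i hp =>
    have hX : evalHom (commute_compression h hT hV) (.X i) = Q * evalHom h (.X i) := by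
      fin_cases i <;> simp
    have e : evalPt (p * .X i) 0 = 0 := by fin_cases i <;> simp [evalPt]
    rw [map_mul, ← mul_assoc, hp, hX, smul_mul_assoc, ← mul_assoc, sub_mul, hQ, e]
    simp

/-- Von Neumann's inequality on `Γ` passes to the compression, extended by `0`. -/
theorem norm_evalHom_compression_le (h : Commute T V) (hQ : Q * Q = Q)
    (hT : Q * T = Q * T * Q) (hV : Q * V = Q * V * Q)
    (hpyth : ∀ x, ‖Q x‖ ^ 2 + ‖x - Q x‖ ^ 2 = ‖x‖ ^ 2)
    (hvN : ∀ p, ‖evalHom h p‖ ≤ gammaSupNorm p 1) (p : MvPolynomial (Fin 2) ℂ) :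
    ‖evalHom (commute_compression h hT hV) p‖ ≤ gammaSupNorm p 1 := by
  have hM := gammaSupNorm_nonneg p 1
  refine ContinuousLinearMap.opNorm_le_bound _ hM fun x => ?_
  set y := evalHom (commute_compression h hT hV) p x
  have h1 : Q y = Q (evalHom h p (Q x)) := congrArg (fun f : K →L[ℂ] K => f x)
    ((mul_evalHom_compression h hQ hT hV p).trans (compression_mul_evalHom h hQ hT hV p))
  have h2 : y - Q y = evalPt p 0 • (x - Q x) := congrArg (fun f : K →L[ℂ] K => f x)
    (one_sub_mul_evalHom_compression h hQ hT hV p)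
  -- The two orthogonal components are estimated separately: one by the inequality for `(T, V)`, the
  -- other by `|p(0, 0)|`, as the origin lies in `Γ`.
  have b1 : ‖Q y‖ ≤ gammaSupNorm p 1 * ‖Q x‖ := by
    rw [h1]
    refine le_trans (le_of_sq_le_sq ?_ (norm_nonneg _))
      (ContinuousLinearMap.le_of_opNorm_le _ (hvN p) (Q x))
    rw [← hpyth (evalHom h p (Q x))]
    exact le_add_of_nonneg_right (sq_nonneg _)
  have b2 : ‖y - Q y‖ ≤ gammaSupNorm p 1 * ‖x - Q x‖ := by
    rw [h2, norm_smul]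
    exact mul_le_mul_of_nonneg_right
      (norm_evalPt_le_gammaSupNorm p zero_mem_closedSymmBidisc) (norm_nonneg _)
  refine le_of_sq_le_sq ?_ (by positivity)
  rw [← hpyth y, mul_pow, ← hpyth x, mul_add, ← mul_pow, ← mul_pow]
  exact add_le_add (pow_le_pow_left₀ (norm_nonneg _) b1 2) (pow_le_pow_left₀ (norm_nonneg _) b2 2)

/-- If a distinguished polynomial annihilates the compression on the range of `Q`, its product with
the polynomial `s` annihilates the extension by `0`. -/
theorem isGammaDistinguished_compression [CompleteSpace K] (h : Commute T V) (hQ : Q * Q = Q)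
    (hT : Q * T = Q * T * Q) (hV : Q * V = Q * V * Q)
    (hpyth : ∀ x, ‖Q x‖ ^ 2 + ‖x - Q x‖ ^ 2 = ‖x‖ ^ 2)
    (hvN : ∀ p, ‖evalHom h p‖ ≤ gammaSupNorm p 1) {p : MvPolynomial (Fin 2) ℂ}
    (hp : IsGammaDistinguishedPoly p) (hp0 : Q * evalHom h p = 0) :
    IsGammaDistinguished (Q * T) (Q * V) := by
  refine ⟨(commute_compression h hT hV).isGammaContraction
    (norm_evalHom_compression_le h hQ hT hV hpyth hvN), _,
    hp.mul isGammaDistinguishedPoly_X, ?_⟩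
  have h1 := mul_evalHom_compression h hQ hT hV (p * MvPolynomial.X 0)
  have h2 := one_sub_mul_evalHom_compression h hQ hT hV (p * MvPolynomial.X 0)
  have h3 : evalPt (p * MvPolynomial.X 0) 0 = 0 := by simp [evalPt]
  rw [map_mul (evalHom h), ← mul_assoc, hp0, zero_mul] at h1
  rwa [h3, zero_smul, sub_mul, one_mul, h1, sub_zero, evalHom_apply] at h2

end Compression

/-! ### Numerical range of the first entry of a `Γ`-contraction `(A, 0)` -/

/-- The difference of squares is a nonnegative combination of `1 - ‖w₁‖²` and `1 - ‖w₂‖²`. Thus `(2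
ζ² p - ζ s) / (2 - ζ s)` is bounded by `1` on `Γ` for `‖ζ‖ < 1`. -/
theorem norm_two_mul_sub_le {w₁ w₂ : ℂ} (h₁ : ‖w₁‖ ≤ 1) (h₂ : ‖w₂‖ ≤ 1) :
    ‖2 * (w₁ * w₂) - (w₁ + w₂)‖ ≤ ‖2 - (w₁ + w₂)‖ := by
  have e : ‖2 - (w₁ + w₂)‖ ^ 2 - ‖2 * (w₁ * w₂) - (w₁ + w₂)‖ ^ 2 =
      2 * (‖1 - w₁‖ ^ 2 * (1 - ‖w₂‖ ^ 2) + ‖1 - w₂‖ ^ 2 * (1 - ‖w₁‖ ^ 2)) := by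
    simp only [← Complex.normSq_eq_norm_sq, Complex.normSq_apply, Complex.sub_re, Complex.sub_im,
      Complex.add_re, Complex.add_im, Complex.mul_re, Complex.mul_im, Complex.one_re,
      Complex.one_im, Complex.re_ofNat, Complex.im_ofNat]
    ring
  refine le_of_sq_le_sq (sub_nonneg.1 ?_) (norm_nonneg _)
  rw [e]
  have := pow_le_one₀ (n := 2) (norm_nonneg _) h₁
  have := pow_le_one₀ (n := 2) (norm_nonneg _) h₂
  have : 0 ≤ 1 - ‖w₂‖ ^ 2 := by linarith
  have : 0 ≤ 1 - ‖w₁‖ ^ 2 := by linarith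
  positivity

section Symbol

variable {E : Type*} [NormedAddCommGroup E] [InnerProductSpace ℂ E]

/-- Von Neumann's inequality for `(2 ζ² p - ζ s) / (2 - ζ s)` at `(A, 0)` gives `‖ζ A x‖ ≤ ‖2 x - ζ
A x‖`; squaring yields the claim. The strict bound on `ζ` keeps the denominator zero-free on `Γ`. -/
theorem IsGammaContraction.re_inner_le_of_lt {A : E →L[ℂ] E} (h : IsGammaContraction A 0) {ζ : ℂ}
    (hζ : ‖ζ‖ < 1) (x : E) : (ζ * inner ℂ x (A x)).re ≤ ‖x‖ ^ 2 := by
  let p : MvPolynomial (Fin 2) ℂ := .C (2 * ζ ^ 2) * .X 1 - .C ζ * .X 0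
  let q : MvPolynomial (Fin 2) ℂ := .C 2 - .C ζ * .X 0
  have hC : ∀ c : ℂ, evalHom h.commute (.C c) = c • 1 := fun c => by
    rw [← MvPolynomial.algebraMap_eq, AlgHom.commutes, Algebra.algebraMap_eq_smul_one]
  have hp : evalOp A 0 p = -(ζ • A) := by
    rw [← evalHom_apply h.commute]; simp [p, hC]
  have hq : evalOp A 0 q = (2 : ℂ) • 1 - ζ • A := by
    rw [← evalHom_apply h.commute]; simp [q, hC]
  have hq0 : ∀ z ∈ closedSymmBidisc, evalPt q z ≠ 0 := by
    intro z hz h0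
    have h1 : ζ * z.1 = 2 := by
      have : (2 : ℂ) - ζ * z.1 = 0 := by simpa [evalPt, q] using h0
      exact (sub_eq_zero.1 this).symm
    have h2 := congrArg norm h1
    rw [norm_mul, Complex.norm_ofNat] at h2
    nlinarith [norm_fst_le_of_mem hz, norm_nonneg z.1, norm_nonneg ζ]
  have hsup : gammaSupNorm p q ≤ 1 := by
    refine gammaSupNorm_le fun z hz => ?_
    rw [norm_div]
    refine div_le_one_of_le₀ ?_ (norm_nonneg _)
    obtain ⟨w, ⟨hw1, hw2⟩, rfl⟩ := hz
    have := norm_two_mul_sub_le (w₁ := ζ * w.1) (w₂ := ζ * w.2)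
      (by rw [norm_mul]; exact mul_le_one₀ hζ.le (norm_nonneg _) hw1)
      (by rw [norm_mul]; exact mul_le_one₀ hζ.le (norm_nonneg _) hw2)
    have ep : evalPt p (symmMap w) = 2 * (ζ * w.1 * (ζ * w.2)) - (ζ * w.1 + ζ * w.2) := by
      simp only [evalPt, p, symmMap, map_sub, map_mul, MvPolynomial.eval_C, MvPolynomial.eval_X,
        Matrix.cons_val_zero, Matrix.cons_val_one]
      ring
    have eq : evalPt q (symmMap w) = 2 - (ζ * w.1 + ζ * w.2) := by
      simp only [evalPt, q, symmMap, map_sub, map_mul, MvPolynomial.eval_C, MvPolynomial.eval_X,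
        Matrix.cons_val_zero]
      ring
    rwa [ep, eq]
  obtain ⟨hu, hle⟩ := h.vonNeumann p q hq0
  have hA : -(ζ • A) = (evalOp A 0 p * Ring.inverse (evalOp A 0 q)) * ((2 : ℂ) • 1 - ζ • A) := by
    rw [← hq, mul_assoc, Ring.inverse_mul_cancel _ hu, mul_one, hp]
  have h1 : ‖ζ • A x‖ ≤ ‖(2 : ℂ) • x - ζ • A x‖ := by
    have h2 : -(ζ • A x) = (evalOp A 0 p * Ring.inverse (evalOp A 0 q))
        ((2 : ℂ) • x - ζ • A x) := congrArg (fun f : E →L[ℂ] E => f x) hA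
    rw [← norm_neg, h2]
    simpa using ContinuousLinearMap.le_of_opNorm_le _ (hle.trans hsup) ((2 : ℂ) • x - ζ • A x)
  have h3 := pow_le_pow_left₀ (norm_nonneg _) h1 2
  rw [@norm_sub_sq ℂ, inner_smul_left, inner_smul_right, norm_smul (2 : ℂ), Complex.norm_ofNat,
    Complex.conj_ofNat] at h3
  have h4 : RCLike.re (2 * (ζ * inner ℂ x (A x))) = 2 * (ζ * inner ℂ x (A x)).re := by simp
  rw [h4] at h3
  nlinarith

theorem IsGammaContraction.re_inner_le {A : E →L[ℂ] E} (h : IsGammaContraction A 0) {u : ℂ}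
    (hu : ‖u‖ = 1) (x : E) : (u * inner ℂ x (A x)).re ≤ ‖x‖ ^ 2 := by
  have hlim : Tendsto (fun r : ℝ => (((r : ℂ) * u) * inner ℂ x (A x)).re) (𝓝[<] 1)
      (𝓝 (u * inner ℂ x (A x)).re) := by
    have : Continuous fun r : ℝ => (((r : ℂ) * u) * inner ℂ x (A x)).re := by fun_prop
    simpa using (this.tendsto 1).mono_left nhdsWithin_le_nhds
  refine le_of_tendsto hlim ?_
  filter_upwards [Ioo_mem_nhdsLT (zero_lt_one' ℝ)] with r hr
  refine h.re_inner_le_of_lt ?_ x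
  rw [norm_mul, hu, mul_one, Complex.norm_real, Real.norm_of_nonneg hr.1.le]
  exact hr.2

/-- The symbol `A + z A*` has norm at most `2` on the circle. -/
theorem IsGammaContraction.norm_add_smul_adjoint_le [CompleteSpace E] {A : E →L[ℂ] E}
    (h : IsGammaContraction A 0) {z : ℂ} (hz : ‖z‖ = 1) :
    ‖A + z • ContinuousLinearMap.adjoint A‖ ≤ 2 := by
  -- Dividing by a square root `w` of `z` turns the symbol into the self-adjoint `B + B*` with `B =
  -- conj w • A`, whose norm is read off its quadratic form.
  obtain ⟨w, hw⟩ := IsAlgClosed.exists_eq_mul_self z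
  have hw1 : ‖w‖ = 1 := by
    have : ‖w‖ * ‖w‖ = 1 := by rw [← norm_mul, ← hw, hz]
    nlinarith [norm_nonneg w]
  have hww : starRingEnd ℂ w * w = 1 := by
    rw [mul_comm, Complex.mul_conj, Complex.normSq_eq_norm_sq, hw1]; simp
  set B := starRingEnd ℂ w • A with hB
  have e : starRingEnd ℂ w • (A + z • ContinuousLinearMap.adjoint A) =
      B + ContinuousLinearMap.adjoint B := by
    rw [hB, LinearIsometryEquiv.map_smulₛₗ, smul_add, smul_smul, hw, ← mul_assoc, hww, one_mul,
      Complex.conj_conj]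
  have hn : ‖A + z • ContinuousLinearMap.adjoint A‖ = ‖B + ContinuousLinearMap.adjoint B‖ := by
    rw [← e, norm_smul, RCLike.norm_conj, hw1, one_mul]
  have hsymm : (B + ContinuousLinearMap.adjoint B).IsSymmetric :=
    ContinuousLinearMap.isSelfAdjoint_iff_isSymmetric.1 (IsSelfAdjoint.add_star_self B)
  rw [hn, ContinuousLinearMap.norm_eq_iSup_rayleighQuotient _ hsymm]
  refine ciSup_le fun x => ?_
  rw [ContinuousLinearMap.rayleighQuotient, ContinuousLinearMap.reApplyInnerSelf_apply]
  rcases eq_or_ne x 0 with rfl | hx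
  · simp
  have hpos : 0 < ‖x‖ ^ 2 := by positivity
  have e2 : RCLike.re (inner ℂ ((B + ContinuousLinearMap.adjoint B) x) x) =
      2 * (starRingEnd ℂ w * inner ℂ x (A x)).re := by
    rw [add_apply, inner_add_left, ContinuousLinearMap.adjoint_inner_left, map_add,
      inner_re_symm, hB, smul_apply, inner_smul_right]
    simp only [RCLike.re_to_complex]
    ring
  have b1 := h.re_inner_le (u := starRingEnd ℂ w) (by rw [RCLike.norm_conj, hw1]) x
  have b2 := h.re_inner_le (u := -starRingEnd ℂ w) (by rw [norm_neg, RCLike.norm_conj, hw1]) x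
  rw [neg_mul, Complex.neg_re] at b2
  rw [e2, abs_div, abs_of_pos hpos, div_le_iff₀ hpos, abs_le]
  constructor <;> linarith

end Symbol

/-! ### Toeplitz operators on `ℓ²(E)` -/

section Sequences

theorem norm_sq_eq_sum_of_eq_zero {E : Type*} [NormedAddCommGroup E] (x : lp (fun _ : ℕ => E) 2) {n : ℕ}
    (hx : ∀ j, n ≤ j → x j = 0) :
    ‖x‖ ^ 2 = ∑ j ∈ Finset.range n, ‖x j‖ ^ 2 := by
  have h : HasSum (fun j => ‖x j‖ ^ 2) (‖x‖ ^ 2) := by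
    simpa using lp.hasSum_norm (p := 2) (by norm_num) x
  refine h.unique (hasSum_sum_of_ne_finset_zero fun j hj => ?_)
  rw [hx j (by simpa using hj)]
  simp

variable {E : Type*} [NormedAddCommGroup E] [InnerProductSpace ℂ E]

theorem truncOp_eq_sum (n : ℕ) (x : ell2 E) :
    truncOp n x = ∑ j ∈ Finset.range n, lp.single 2 j (x j) := by
  refine lp.ext (funext fun k => ?_)
  rw [truncOp_apply, lp.coeFn_sum, Finset.sum_apply]
  simp [Pi.single_apply]

theorem tendsto_truncOp (x : ell2 E) : Tendsto (fun n => truncOp n x) atTop (𝓝 x) := by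
  simp only [truncOp_eq_sum]
  exact (lp.hasSum_single (by simp) x).tendsto_sum_nat

/-- Parseval's identity for the discrete Fourier transform of a vector valued sequence. -/
theorem sum_norm_sq_sum_pow_smul {N : ℕ} {ω : ℂ} (hω : IsPrimitiveRoot ω N) (hN : N ≠ 0)
    (x : ℕ → E) :
    ∑ m ∈ Finset.range N, ‖∑ j ∈ Finset.range N, (ω ^ m) ^ j • x j‖ ^ 2 =
      N * ∑ j ∈ Finset.range N, ‖x j‖ ^ 2 := by
  have hω1 : ‖ω‖ = 1 := hω.norm'_eq_one hN
  have hconj : ∀ j, starRingEnd ℂ (ω ^ j) * ω ^ j = 1 := fun j => by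
    rw [mul_comm, Complex.mul_conj, Complex.normSq_eq_norm_sq, norm_pow, hω1]; simp
  have horth : ∀ j ∈ Finset.range N, ∀ k ∈ Finset.range N,
      ∑ m ∈ Finset.range N, (starRingEnd ℂ (ω ^ j) * ω ^ k) ^ m = if j = k then (N : ℂ) else 0 := by
    intro j hj k hk
    split_ifs with hjk
    · subst hjk
      simp only [hconj, one_pow, Finset.sum_const, Finset.card_range, nsmul_eq_mul, mul_one]
    · set ζ := starRingEnd ℂ (ω ^ j) * ω ^ k
      have hζ : ζ ≠ 1 := by
        intro h1
        have h2 : ω ^ k = ω ^ j := by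
          calc ω ^ k = (starRingEnd ℂ (ω ^ j) * ω ^ j) * ω ^ k := by rw [hconj, one_mul]
            _ = ω ^ j * ζ := by ring
            _ = ω ^ j := by rw [h1, mul_one]
        exact hjk (hω.pow_inj (Finset.mem_range.1 hj) (Finset.mem_range.1 hk) h2.symm)
      have hζN : ζ ^ N = 1 := by
        rw [mul_pow, ← map_pow, ← pow_mul, ← pow_mul, mul_comm j, mul_comm k, pow_mul, pow_mul,
          hω.pow_eq_one]
        simp
      have := mul_geom_sum ζ N
      rw [hζN, sub_self] at this
      exact (mul_eq_zero.1 this).resolve_left (sub_ne_zero.2 hζ)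
  have hC : (∑ m ∈ Finset.range N, ((‖∑ j ∈ Finset.range N, (ω ^ m) ^ j • x j‖ : ℝ) : ℂ) ^ 2) =
      N * ∑ j ∈ Finset.range N, ((‖x j‖ : ℝ) : ℂ) ^ 2 := by
    calc _ = ∑ m ∈ Finset.range N, ∑ j ∈ Finset.range N, ∑ k ∈ Finset.range N,
          (starRingEnd ℂ (ω ^ j) * ω ^ k) ^ m * inner ℂ (x j) (x k) := by
          refine Finset.sum_congr rfl fun m _ => ?_
          have := inner_self_eq_norm_sq_to_K (𝕜 := ℂ) (∑ j ∈ Finset.range N, (ω ^ m) ^ j • x j)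
          refine this.symm.trans ?_
          rw [sum_inner]
          refine Finset.sum_congr rfl fun j _ => ?_
          rw [inner_sum]
          refine Finset.sum_congr rfl fun k _ => ?_
          rw [inner_smul_left, inner_smul_right, mul_pow, ← map_pow, ← pow_mul, ← pow_mul,
            ← pow_mul, ← pow_mul, mul_comm m, mul_comm m, mul_assoc]
      _ = ∑ j ∈ Finset.range N, ∑ k ∈ Finset.range N,
          (∑ m ∈ Finset.range N, (starRingEnd ℂ (ω ^ j) * ω ^ k) ^ m) * inner ℂ (x j) (x k) := by
          rw [Finset.sum_comm]
          refine Finset.sum_congr rfl fun j _ => ?_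
          rw [Finset.sum_comm]
          exact Finset.sum_congr rfl fun k _ => (Finset.sum_mul _ _ _).symm
      _ = ∑ j ∈ Finset.range N, (N : ℂ) * ((‖x j‖ : ℝ) : ℂ) ^ 2 := by
          refine Finset.sum_congr rfl fun j hj => ?_
          rw [Finset.sum_eq_single_of_mem j hj fun k hk hkj => by
            rw [horth j hj k hk, if_neg hkj.symm, zero_mul], horth j hj j hj, if_pos rfl]
          congr 1
          exact inner_self_eq_norm_sq_to_K (𝕜 := ℂ) (x j)
      _ = _ := (Finset.mul_sum _ _ _).symm
  exact_mod_cast hC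

theorem inner_shiftOp_shiftOp (x y : ell2 E) :
    inner ℂ (shiftOp x) (shiftOp y) = inner ℂ x y := by
  refine (lp.hasSum_inner _ _).unique ?_
  rw [← hasSum_nat_add_iff' 1]
  simpa using lp.hasSum_inner (𝕜 := ℂ) x y

theorem diagOp_shiftOp (A : E →L[ℂ] E) (x : ell2 E) :
    diagOp A (shiftOp x) = shiftOp (diagOp A x) := by
  refine lp.ext (funext fun j => ?_)
  cases j <;> simp

variable [CompleteSpace E]

theorem toeplitzD_apply_zero (A : E →L[ℂ] E) (x : ell2 E) : toeplitzD A x 0 = A (x 0) := by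
  change A (x 0) + 0 = _
  rw [add_zero]

theorem toeplitzD_apply_succ (A : E →L[ℂ] E) (x : ell2 E) (j : ℕ) :
    toeplitzD A x (j + 1) = A (x (j + 1)) + ContinuousLinearMap.adjoint A (x j) := rfl

/-- The symbol of `toeplitzD A` is `A + z A*`. -/
theorem sum_pow_smul_toeplitzD (A : E →L[ℂ] E) (x : ell2 E) (n : ℕ) (hx : x n = 0) (z : ℂ) :
    ∑ j ∈ Finset.range (n + 1), z ^ j • toeplitzD A x j =
      (A + z • ContinuousLinearMap.adjoint A) (∑ j ∈ Finset.range (n + 1), z ^ j • x j) := by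
  have h1 : ∑ j ∈ Finset.range (n + 1), z ^ j • toeplitzD A x j =
      ∑ j ∈ Finset.range (n + 1), z ^ j • A (x j) +
        ∑ j ∈ Finset.range n, z ^ (j + 1) • ContinuousLinearMap.adjoint A (x j) := by
    rw [Finset.sum_range_succ', Finset.sum_range_succ' (fun j => z ^ j • A (x j)),
      toeplitzD_apply_zero, add_right_comm, ← Finset.sum_add_distrib]
    simp only [toeplitzD_apply_succ, smul_add]
  -- The vanishing last entry leaves room for the shift, so nothing leaves the window.
  have h2 : ∑ j ∈ Finset.range (n + 1), z ^ j • x j = ∑ j ∈ Finset.range n, z ^ j • x j := by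
    rw [Finset.sum_range_succ, hx, smul_zero, add_zero]
  rw [h1, add_apply, smul_apply, map_sum]
  congr 1
  · simp only [map_smul]
  · rw [h2, map_sum, Finset.smul_sum]
    refine Finset.sum_congr rfl fun j _ => ?_
    rw [map_smul, smul_smul, pow_succ']

/-- For finitely supported sequences a discrete Fourier transform turns `toeplitzD A` into
multiplication by the symbol at roots of unity, and Parseval gives the bound. The transform has
length `n + 1` because the operator lengthens the support by one. Density does the rest. -/
theorem norm_toeplitzD_le {A : E →L[ℂ] E}
    (hA : ∀ z : ℂ, ‖z‖ = 1 → ‖A + z • ContinuousLinearMap.adjoint A‖ ≤ 2) :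
    ‖toeplitzD A‖ ≤ 2 := by
  have key : ∀ (n : ℕ) (x : ell2 E), (∀ j, n ≤ j → x j = 0) → ‖toeplitzD A x‖ ≤ 2 * ‖x‖ := by
    intro n x hx
    have hω := Complex.isPrimitiveRoot_exp (n + 1) n.succ_ne_zero
    set ω := Complex.exp (2 * Real.pi * Complex.I / (n + 1 : ℕ))
    have hω1 : ‖ω‖ = 1 := hω.norm'_eq_one n.succ_ne_zero
    have e1 := norm_sq_eq_sum_of_eq_zero x (n := n + 1) fun j hj => hx j (by lia)
    have e2 := norm_sq_eq_sum_of_eq_zero (toeplitzD A x) (n := n + 1) fun j hj => by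
      obtain ⟨j, rfl⟩ : ∃ k, j = k + 1 := ⟨j - 1, by lia⟩
      rw [toeplitzD_apply_succ, hx _ (by lia), hx _ (by lia), map_zero, map_zero, add_zero]
    have p1 := sum_norm_sq_sum_pow_smul hω n.succ_ne_zero x
    have p2 := sum_norm_sq_sum_pow_smul hω n.succ_ne_zero (toeplitzD A x)
    rw [← e1] at p1
    rw [← e2] at p2
    have hle : ((n + 1 : ℕ) : ℝ) * ‖toeplitzD A x‖ ^ 2 ≤ 4 * (((n + 1 : ℕ) : ℝ) * ‖x‖ ^ 2) := by
      rw [← p1, ← p2, Finset.mul_sum]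
      refine Finset.sum_le_sum fun m _ => ?_
      rw [sum_pow_smul_toeplitzD A x n (hx n le_rfl)]
      have := ContinuousLinearMap.le_of_opNorm_le _ (hA (ω ^ m) (by rw [norm_pow, hω1, one_pow]))
        (∑ j ∈ Finset.range (n + 1), (ω ^ m) ^ j • x j)
      calc _ ≤ _ := pow_le_pow_left₀ (norm_nonneg _) this 2
        _ = _ := by ring
    have hn : (0 : ℝ) < (n + 1 : ℕ) := by positivity
    refine le_of_sq_le_sq ?_ (by positivity)
    rw [mul_pow]
    nlinarith
  refine ContinuousLinearMap.opNorm_le_bound _ zero_le_two fun x => ?_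
  have hx := tendsto_truncOp x
  refine le_of_tendsto_of_tendsto' (((toeplitzD A).continuous.tendsto x).comp hx).norm
    (hx.norm.const_mul 2) fun n => ?_
  exact key n _ fun j hj => by rw [truncOp_apply, if_neg (by lia)]

theorem inner_diagOp_left (A : E →L[ℂ] E) (x y : ell2 E) :
    inner ℂ (diagOp A x) y = inner ℂ x (diagOp (ContinuousLinearMap.adjoint A) y) := by
  refine (lp.hasSum_inner _ _).unique ?_
  convert! lp.hasSum_inner (𝕜 := ℂ) x (diagOp (ContinuousLinearMap.adjoint A) y) using 2 with j
  rw [diagOp_apply, diagOp_apply, ContinuousLinearMap.adjoint_inner_right]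

/-- On the circle, `(A + z A*)* z = A + z A*`. -/
theorem inner_toeplitzD (A : E →L[ℂ] E) (x y : ell2 E) :
    inner ℂ (toeplitzD A x) y = inner ℂ (shiftOp x) (toeplitzD A y) := by
  change inner ℂ (diagOp A x + shiftOp (diagOp _ x)) y =
    inner ℂ (shiftOp x) (diagOp A y + shiftOp (diagOp _ y))
  rw [inner_add_left, inner_add_right, inner_shiftOp_shiftOp, inner_diagOp_left, add_comm,
    ← diagOp_shiftOp, inner_diagOp_left, ContinuousLinearMap.adjoint_adjoint]

end Sequences

/-! ### The defect operator and the fundamental operator -/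

section DefectIdentities

variable {H : Type*} [NormedAddCommGroup H] [InnerProductSpace ℂ H] [CompleteSpace H]

theorem inner_defectOp_left (P : H →L[ℂ] H) (u v : H) :
    inner ℂ (defectOp P u) v = inner ℂ u (defectOp P v) :=
  (ContinuousLinearMap.isSelfAdjoint_iff_isSymmetric.1
    (IsSelfAdjoint.of_nonneg (CFC.sqrt_nonneg _))) u v

theorem defectOp_defectOp {P : H →L[ℂ] H} (hP : ‖P‖ ≤ 1) (x : H) :
    defectOp P (defectOp P x) = x - ContinuousLinearMap.adjoint P (P x) := by
  have hpos : 0 ≤ 1 - ContinuousLinearMap.adjoint P * P := by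
    rw [ContinuousLinearMap.nonneg_iff_isPositive]
    refine ⟨ContinuousLinearMap.isSelfAdjoint_iff_isSymmetric.1
      ((IsSelfAdjoint.one _).sub (IsSelfAdjoint.star_mul_self P)), fun x => ?_⟩
    have e : (1 - ContinuousLinearMap.adjoint P * P) x =
      x - ContinuousLinearMap.adjoint P (P x) := rfl
    rw [ContinuousLinearMap.reApplyInnerSelf_apply, e, inner_sub_left,
      ContinuousLinearMap.adjoint_inner_left, map_sub, inner_self_eq_norm_sq,
      inner_self_eq_norm_sq, sub_nonneg]
    have := P.le_of_opNorm_le hP x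
    rw [one_mul] at this
    exact pow_le_pow_left₀ (norm_nonneg _) this 2
  exact congrArg (fun f : H →L[ℂ] H => f x) (CFC.sqrt_mul_sqrt_self _ hpos)

theorem inner_defectMap_left (P : H →L[ℂ] H) (u : H) (y : defectSpace P) :
    inner ℂ (defectMap P u) y = inner ℂ u (defectOp P y) :=
  inner_defectOp_left P u y

theorem norm_sq_add_norm_defectMap_sq {P : H →L[ℂ] H} (hP : ‖P‖ ≤ 1) (x : H) :
    ‖P x‖ ^ 2 + ‖defectMap P x‖ ^ 2 = ‖x‖ ^ 2 := by
  have h1 : ‖defectMap P x‖ ^ 2 = RCLike.re (inner ℂ (defectMap P x) (defectMap P x)) :=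
    (inner_self_eq_norm_sq _).symm
  have h2 : inner ℂ (defectMap P x) (defectMap P x) =
      inner ℂ x (x - ContinuousLinearMap.adjoint P (P x)) := by
    rw [← defectOp_defectOp hP]
    exact inner_defectMap_left P x _
  rw [h1, h2, inner_sub_right, ContinuousLinearMap.adjoint_inner_right, map_sub,
    inner_self_eq_norm_sq, inner_self_eq_norm_sq]
  ring

theorem eq_zero_of_defectOp_eq_zero {P : H →L[ℂ] H} {y : defectSpace P}
    (hy : defectOp P y = 0) : y = 0 := by
  have h1 : (y : H) ∈ (defectSpace P)ᗮ := by
    rw [Submodule.orthogonal_closure, Submodule.mem_orthogonal]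
    rintro _ ⟨z, rfl⟩
    exact (inner_defectOp_left P z y).trans (by rw [hy, inner_zero_right])
  have h2 : (y : H) ∈ defectSpace P ⊓ (defectSpace P)ᗮ := ⟨y.2, h1⟩
  rw [Submodule.inf_orthogonal_eq_bot] at h2
  exact Subtype.ext h2

variable {S P : H →L[ℂ] H} {A : defectSpace P →L[ℂ] defectSpace P}

theorem IsFundamentalOperator.defectOp_adjoint (h : IsFundamentalOperator S P A) (x : H) :
    defectOp P (ContinuousLinearMap.adjoint A (defectMap P x) : defectSpace P) =
      ContinuousLinearMap.adjoint S x - ContinuousLinearMap.adjoint P (S x) := by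
  refine ext_inner_left ℂ fun v => ?_
  rw [← inner_defectMap_left, ContinuousLinearMap.adjoint_inner_right, inner_sub_right,
    ContinuousLinearMap.adjoint_inner_right, ContinuousLinearMap.adjoint_inner_right,
    ← inner_conj_symm, inner_defectMap_left, ← h v, inner_sub_right,
    ContinuousLinearMap.adjoint_inner_right, map_sub, inner_conj_symm, inner_conj_symm]

/-- The identity `D_P S = A D_P + A* D_P P`. -/
theorem IsFundamentalOperator.defectMap_apply (h : IsFundamentalOperator S P A)
    (hc : Commute S P) (hP : ‖P‖ ≤ 1) (x : H) :
    ContinuousLinearMap.adjoint A (defectMap P (P x)) + A (defectMap P x) =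
      defectMap P (S x) := by
  -- `D_P` is injective on the defect space. After applying it, the left side is `(S* P - P* S P) x
  -- + (S - S* P) x = (1 - P* P) S x`.
  refine sub_eq_zero.1 (eq_zero_of_defectOp_eq_zero ?_)
  rw [Submodule.coe_sub, Submodule.coe_add, map_sub, map_add, h.defectOp_adjoint, ← h x]
  change _ - defectOp P (defectOp P (S x)) = 0
  rw [defectOp_defectOp hP, commute_apply hc]
  abel

end DefectIdentities

/-! ### The pair `(T_A, V₀)` -/

section DilationSpaceNorm

theorem dilationSpace_ext {H E : Type*} [NormedAddCommGroup E]
    {x y : WithLp 2 (H × lp (fun _ : ℕ => E) 2)} (h0 : x.fst = y.fst)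
    (h1 : ∀ j, x.snd j = y.snd j) : x = y :=
  WithLp.ofLp_injective 2 (Prod.ext h0 (lp.ext (funext h1)))

variable {H E : Type*} [NormedAddCommGroup H] [NormedAddCommGroup E]

theorem norm_sq_dilationSpace (x : WithLp 2 (H × lp (fun _ : ℕ => E) 2)) :
    ‖x‖ ^ 2 = ‖x.fst‖ ^ 2 + ‖x.snd‖ ^ 2 :=
  WithLp.prod_norm_sq_eq_of_L2 x

theorem norm_fst_dilationSpace_le (x : WithLp 2 (H × lp (fun _ : ℕ => E) 2)) : ‖x.fst‖ ≤ ‖x‖ :=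
  le_of_sq_le_sq (by rw [norm_sq_dilationSpace]; exact le_add_of_nonneg_right (sq_nonneg _))
    (norm_nonneg _)

theorem norm_snd_dilationSpace_le (x : WithLp 2 (H × lp (fun _ : ℕ => E) 2)) : ‖x.snd‖ ≤ ‖x‖ :=
  le_of_sq_le_sq (by rw [norm_sq_dilationSpace]; exact le_add_of_nonneg_left (sq_nonneg _))
    (norm_nonneg _)

theorem norm_dilationSpace_le (x : WithLp 2 (H × lp (fun _ : ℕ => E) 2)) : ‖x‖ ≤ ‖x.fst‖ + ‖x.snd‖ := by
  refine le_of_sq_le_sq ?_ (by positivity)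
  rw [norm_sq_dilationSpace]
  nlinarith [norm_nonneg x.fst, norm_nonneg x.snd]

end DilationSpaceNorm

section Dilation

variable {H E : Type*} [NormedAddCommGroup H] [InnerProductSpace ℂ H]
  [NormedAddCommGroup E] [InnerProductSpace ℂ E]

theorem inner_dilationSpace (x y : dilationSpace H E) :
    inner ℂ x y = inner ℂ x.fst y.fst + inner ℂ x.snd y.snd :=
  WithLp.prod_inner_apply x y

/-- Powers of a lower triangular block operator with diagonal entries of norm at most `2`. -/
theorem norm_lowerBlock_pow_le {S : H →L[ℂ] H} {C : H →L[ℂ] ell2 E} {D : ell2 E →L[ℂ] ell2 E}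
    (hS : ‖S‖ ≤ 2) (hD : ‖D‖ ≤ 2) (k : ℕ) :
    ‖lowerBlock S C D ^ k‖ ≤ (2 + ‖C‖) * (k + 1) * 2 ^ k := by
  -- The corner of the `k`-th power is a sum of `k` products `Dⁱ C Sʲ` with `i + j = k - 1`, hence
  -- growth only linear in `k` beyond `2 ^ k`.
  have key : ∀ (k : ℕ) (x : dilationSpace H E),
      ‖((lowerBlock S C D ^ k) x).fst‖ ≤ 2 ^ k * ‖x‖ ∧
        ‖((lowerBlock S C D ^ k) x).snd‖ ≤ 2 ^ k * (1 + k * ‖C‖) * ‖x‖ := by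
    intro k x
    induction k with
    | zero => simpa using ⟨norm_fst_dilationSpace_le x, norm_snd_dilationSpace_le x⟩
    | succ k ih =>
      rw [pow_succ']
      set y := (lowerBlock S C D ^ k) x
      constructor
      · change ‖S y.fst‖ ≤ _
        refine (S.le_of_opNorm_le hS _).trans ?_
        rw [pow_succ]
        linarith [ih.1]
      · change ‖C y.fst + D y.snd‖ ≤ _
        have h1 := (C.le_opNorm y.fst).trans (mul_le_mul_of_nonneg_left ih.1 (norm_nonneg C))
        have h2 := D.le_of_opNorm_le hD y.snd
        have h3 : 0 ≤ 2 ^ k * ‖C‖ * ‖x‖ := by positivity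
        refine (norm_add_le _ _).trans ?_
        rw [pow_succ]
        push_cast
        nlinarith [ih.2]
  refine ContinuousLinearMap.opNorm_le_bound _ (by positivity) fun x => ?_
  refine (norm_dilationSpace_le _).trans ((add_le_add (key k x).1 (key k x).2).trans ?_)
  have h1 : 0 ≤ 2 ^ k * ‖x‖ * (2 * k + ‖C‖) := by positivity
  nlinarith

variable (H E) in
/-- The projection `(x₀, x₁, …) ↦ (x₀, …, xₙ, 0, 0, …)`. -/
def truncProj (n : ℕ) : dilationSpace H E →L[ℂ] dilationSpace H E :=
  lowerBlock 1 0 (truncOp n)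

theorem truncProj_fst (n : ℕ) (x : dilationSpace H E) : (truncProj H E n x).fst = x.fst := rfl

theorem truncProj_snd (n : ℕ) (x : dilationSpace H E) (j : ℕ) :
    (truncProj H E n x).snd j = if j < n then x.snd j else 0 := by
  have : (truncProj H E n x).snd = truncOp n x.snd := zero_add _
  rw [this, truncOp_apply]

theorem truncProj_mul_self (n : ℕ) : truncProj H E n * truncProj H E n = truncProj H E n := by
  refine ContinuousLinearMap.ext fun x => dilationSpace_ext ?_ fun j => ?_
  · rw [mul_apply_eq_comp, truncProj_fst]
  rw [mul_apply_eq_comp, truncProj_snd]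
  split_ifs with hj
  · rfl
  · rw [truncProj_snd, if_neg hj]

theorem norm_sq_truncProj_add (n : ℕ) (x : dilationSpace H E) :
    ‖truncProj H E n x‖ ^ 2 + ‖x - truncProj H E n x‖ ^ 2 = ‖x‖ ^ 2 := by
  have h0 : inner ℂ (truncProj H E n x) (x - truncProj H E n x) = 0 := by
    rw [inner_dilationSpace]
    have h1 : (x - truncProj H E n x).fst = 0 := sub_self x.fst
    rw [h1, inner_zero_right, zero_add]
    refine (lp.hasSum_inner _ _).unique ?_
    convert! hasSum_zero using 2 with j
    change inner ℂ ((truncProj H E n x).snd j) (x.snd j - (truncProj H E n x).snd j) = 0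
    rw [truncProj_snd]
    split_ifs
    · rw [sub_self, inner_zero_right]
    · rw [inner_zero_left]
  have h1 := @norm_add_sq ℂ _ _ _ _ (truncProj H E n x) (x - truncProj H E n x)
  rw [h0, map_zero, mul_zero, add_zero, add_sub_cancel] at h1
  exact h1.symm

variable [CompleteSpace H] {S P : H →L[ℂ] H} {A : defectSpace P →L[ℂ] defectSpace P}

theorem commute_dilT_dilV (h : IsFundamentalOperator S P A) (hc : Commute S P) (hP : ‖P‖ ≤ 1) :
    Commute (dilT S P A) (dilV P) := by
  refine ContinuousLinearMap.ext fun x => ?_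
  rw [mul_apply_eq_comp, mul_apply_eq_comp]
  refine dilationSpace_ext ?_ fun j => ?_
  · rw [dilT_fst, dilV_fst, dilV_fst, dilT_fst, commute_apply hc]
  · rcases j with _ | _ | j
    -- Only this entry needs the fundamental operator, through `D_P S = A D_P + A* D_P P`.
    · rw [dilT_snd_zero, dilV_snd_zero, dilV_snd_zero, dilV_fst, dilT_fst,
        h.defectMap_apply hc hP]
    · rw [dilT_snd_succ, dilV_snd_zero, dilV_snd_succ, dilV_snd_succ, dilT_snd_zero]
    · rw [dilT_snd_succ, dilV_snd_succ, dilV_snd_succ, dilV_snd_succ, dilT_snd_succ]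

/-- Isometry is `‖P x‖² + ‖D_P x‖² = ‖x‖²`. In `T = T* V` the corner on `H` is the adjoint
fundamental equation, and the `ℓ²` block is `inner_toeplitzD`. -/
theorem isToeplitzPair_dilT_dilV (h : IsFundamentalOperator S P A) (hc : Commute S P)
    (hP : ‖P‖ ≤ 1) : IsToeplitzPair (dilT S P A) (dilV P) := by
  refine ⟨commute_dilT_dilV h hc hP, fun x => ?_, fun x y => ?_⟩
  · rw [← sq_eq_sq₀ (norm_nonneg _) (norm_nonneg _), norm_sq_dilationSpace, norm_sq_dilationSpace]
    change ‖P x.fst‖ ^ 2 + ‖lp.single 2 0 (defectMap P x.fst) + shiftOp x.snd‖ ^ 2 = _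
    have h1 : ‖shiftOp x.snd‖ ^ 2 = ‖x.snd‖ ^ 2 := by
      rw [← inner_self_eq_norm_sq (𝕜 := ℂ), inner_shiftOp_shiftOp, inner_self_eq_norm_sq]
    rw [@norm_add_sq ℂ, lp.inner_single_left, shiftOp_zero, inner_zero_right, map_zero, h1,
      lp.norm_single (by simp), mul_zero, add_zero, ← add_assoc,
      norm_sq_add_norm_defectMap_sq hP]
  · rw [inner_dilationSpace, inner_dilationSpace]
    change inner ℂ (S x.fst) y.fst + inner ℂ (lp.single 2 0 (ContinuousLinearMap.adjoint A
        (defectMap P x.fst)) + toeplitzD A x.snd) y.snd =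
      inner ℂ (P x.fst) (S y.fst) + inner ℂ (lp.single 2 0 (defectMap P x.fst) + shiftOp x.snd)
        (lp.single 2 0 (ContinuousLinearMap.adjoint A (defectMap P y.fst)) + toeplitzD A y.snd)
    have h1 : inner ℂ (defectMap P x.fst) (ContinuousLinearMap.adjoint A (defectMap P y.fst)) =
        inner ℂ (S x.fst) y.fst - inner ℂ (P x.fst) (S y.fst) := by
      rw [inner_defectMap_left, h.defectOp_adjoint, inner_sub_right,
        ContinuousLinearMap.adjoint_inner_right, ContinuousLinearMap.adjoint_inner_right]
    rw [inner_add_left, inner_add_left, inner_add_right, inner_add_right, lp.inner_single_left,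
      lp.inner_single_left, lp.inner_single_left, lp.inner_single_right, shiftOp_zero,
      inner_zero_left, toeplitzD_apply_zero, ContinuousLinearMap.adjoint_inner_left,
      lp.single_apply_self, h1, inner_toeplitzD]
    ring

/-- Triangularity alone controls only the growth rate of the powers; the Toeplitz relation turns
this rate into a bound on the norm. -/
theorem norm_dilT_le (h : IsFundamentalOperator S P A) (hSP : IsGammaContraction S P)
    (hA : IsGammaContraction A 0) : ‖dilT S P A‖ ≤ 2 :=
  (isToeplitzPair_dilT_dilV h hSP.commute hSP.norm_snd_le).norm_le_of_norm_pow_le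
    (fst_mem_pairAlg _ _) two_pos (norm_lowerBlock_pow_le hSP.norm_fst_le
      (norm_toeplitzD_le fun _ => hA.norm_add_smul_adjoint_le))

/-! ### Truncations -/

/-- The column `colC` in `truncT` is not truncated, so `n = 0` must be excluded. -/
theorem truncT_eq {n : ℕ} (hn : 1 ≤ n) :
    truncT S P A n = truncProj H (defectSpace P) n * dilT S P A := by
  obtain ⟨n, rfl⟩ : ∃ k, n = k + 1 := ⟨n - 1, by lia⟩
  refine ContinuousLinearMap.ext fun x => dilationSpace_ext ?_ fun j => ?_
  · rw [mul_apply_eq_comp, truncProj_fst, truncT_fst, dilT_fst]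
  rw [mul_apply_eq_comp, truncProj_snd]
  cases j with
  | zero => rw [truncT_snd_zero, dilT_snd_zero, if_pos n.succ_pos]
  | succ j => rw [truncT_snd_succ, dilT_snd_succ]

theorem truncV_eq {n : ℕ} (hn : 1 ≤ n) :
    truncV P n = truncProj H (defectSpace P) n * dilV P := by
  refine ContinuousLinearMap.ext fun x => dilationSpace_ext ?_ fun j => ?_
  · rw [mul_apply_eq_comp, truncProj_fst, truncV_fst, dilV_fst]
  rw [mul_apply_eq_comp, truncProj_snd]
  cases j with
  | zero => rw [truncV_snd_zero, dilV_snd_zero, if_pos (show 0 < n from hn)]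
  | succ j => rw [truncV_snd_succ, dilV_snd_succ]

/-- Lower triangularity: the retained entries of the output depend only on retained entries of the
input. -/
theorem truncProj_mul_dilT (n : ℕ) : truncProj H (defectSpace P) n * dilT S P A =
    truncProj H (defectSpace P) n * dilT S P A * truncProj H (defectSpace P) n := by
  refine ContinuousLinearMap.ext fun x => dilationSpace_ext ?_ fun j => ?_
  · rw [mul_apply_eq_comp, mul_apply_eq_comp, mul_apply_eq_comp, truncProj_fst, truncProj_fst,
      dilT_fst, dilT_fst, truncProj_fst]
  rw [mul_apply_eq_comp, mul_apply_eq_comp, mul_apply_eq_comp, truncProj_snd, truncProj_snd]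
  split_ifs with hj
  · cases j with
    | zero => rw [dilT_snd_zero, dilT_snd_zero, truncProj_fst, truncProj_snd, if_pos hj]
    | succ j => rw [dilT_snd_succ, dilT_snd_succ, truncProj_snd, truncProj_snd, if_pos hj,
        if_pos (by lia)]
  · rfl

theorem truncProj_mul_dilV (n : ℕ) : truncProj H (defectSpace P) n * dilV P =
    truncProj H (defectSpace P) n * dilV P * truncProj H (defectSpace P) n := by
  refine ContinuousLinearMap.ext fun x => dilationSpace_ext ?_ fun j => ?_
  · rw [mul_apply_eq_comp, mul_apply_eq_comp, mul_apply_eq_comp, truncProj_fst, truncProj_fst,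
      dilV_fst, dilV_fst, truncProj_fst]
  rw [mul_apply_eq_comp, mul_apply_eq_comp, mul_apply_eq_comp, truncProj_snd, truncProj_snd]
  split_ifs with hj
  · cases j with
    | zero => rw [dilV_snd_zero, dilV_snd_zero, truncProj_fst]
    | succ j => rw [dilV_snd_succ, dilV_snd_succ, truncProj_snd, if_pos (by lia)]
  · rfl

/-! ### Annihilating polynomials -/

theorem evalHom_dil_fst (hc : Commute S P) (hd : Commute (dilT S P A) (dilV P))
    (p : MvPolynomial (Fin 2) ℂ) (x : dilationSpace H (defectSpace P)) :
    (evalHom hd p x).fst = evalHom hc p x.fst := by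
  induction p using MvPolynomial.induction_on generalizing x with
  | C a =>
    rw [← MvPolynomial.algebraMap_eq, AlgHom.commutes, AlgHom.commutes]
    rfl
  | add p q hp hq =>
    rw [map_add, map_add, add_apply, add_apply, ← hp, ← hq]
    rfl
  | mul_X p i hp =>
    rw [map_mul, map_mul, mul_apply_eq_comp, mul_apply_eq_comp, hp]
    congr 1
    fin_cases i
    · simp [dilT_fst]
    · simp [dilV_fst]

/-- On sequences that vanish before entry `j + 1`, the diagonal entry of `p(T_A, V₀)` is
`p(A, 0)`. -/
theorem evalHom_dil_snd (hA : Commute A 0) (hd : Commute (dilT S P A) (dilV P))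
    (p : MvPolynomial (Fin 2) ℂ) {j : ℕ} {x : dilationSpace H (defectSpace P)}
    (hx0 : x.fst = 0) (hx : ∀ i < j, x.snd i = 0) :
    (evalHom hd p x).fst = 0 ∧ (∀ i < j, (evalHom hd p x).snd i = 0) ∧
      (evalHom hd p x).snd j = evalHom hA p (x.snd j) := by
  induction p using MvPolynomial.induction_on generalizing x with
  | C a =>
    rw [← MvPolynomial.algebraMap_eq, AlgHom.commutes, AlgHom.commutes]
    refine ⟨?_, fun i hi => ?_, rfl⟩
    · change a • x.fst = 0
      rw [hx0, smul_zero]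
    · change a • x.snd i = 0
      rw [hx i hi, smul_zero]
  | add p q hp hq =>
    obtain ⟨p1, p2, p3⟩ := hp hx0 hx
    obtain ⟨q1, q2, q3⟩ := hq hx0 hx
    rw [map_add, map_add, add_apply, add_apply, ← p3, ← q3]
    refine ⟨?_, fun i hi => ?_, rfl⟩
    · change (evalHom hd p x).fst + (evalHom hd q x).fst = 0
      rw [p1, q1, add_zero]
    · change (evalHom hd p x).snd i + (evalHom hd q x).snd i = 0
      rw [p2 i hi, q2 i hi, add_zero]
  | mul_X p k hp =>
    have hX : (evalHom hd (.X k) x).fst = 0 ∧ (∀ i < j, (evalHom hd (.X k) x).snd i = 0) ∧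
        (evalHom hd (.X k) x).snd j = evalHom hA (.X k) (x.snd j) := by
      fin_cases k
      · simp only [Fin.zero_eta, evalHom_X_zero]
        refine ⟨by rw [dilT_fst, hx0, map_zero], fun i hi => ?_, ?_⟩
        · cases i with
          | zero => rw [dilT_snd_zero, hx0, hx 0 hi]; simp
          | succ i => rw [dilT_snd_succ, hx _ hi, hx i (by lia)]; simp
        · cases j with
          | zero => rw [dilT_snd_zero, hx0]; simp
          | succ j => rw [dilT_snd_succ, hx j (by lia)]; simp
      · simp only [Fin.mk_one, evalHom_X_one]
        refine ⟨by rw [dilV_fst, hx0, map_zero], fun i hi => ?_, ?_⟩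
        · cases i with
          | zero => rw [dilV_snd_zero, hx0, map_zero]
          | succ i => rw [dilV_snd_succ, hx i (by lia)]
        · cases j with
          | zero => rw [dilV_snd_zero, hx0, map_zero]; rfl
          | succ j => rw [dilV_snd_succ, hx j (by lia)]; rfl
    rw [map_mul, map_mul, mul_apply_eq_comp, mul_apply_eq_comp, ← hX.2.2]
    exact hp hX.1 hX.2.1

/-- The diagonal entry `p(A, 0)` vanishes, so each factor `p(T_A, V₀)` clears one more leading
entry. -/
theorem evalHom_dil_pow_snd (hA : Commute A 0) (hd : Commute (dilT S P A) (dilV P))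
    {p : MvPolynomial (Fin 2) ℂ} (hp : evalHom hA p = 0) {x : dilationSpace H (defectSpace P)}
    (hx0 : x.fst = 0) (n : ℕ) : (evalHom hd (p ^ n) x).fst = 0 ∧
      ∀ i < n, (evalHom hd (p ^ n) x).snd i = 0 := by
  induction n with
  | zero => exact ⟨by simpa using hx0, by simp⟩
  | succ n ih =>
    rw [pow_succ', map_mul, mul_apply_eq_comp]
    obtain ⟨h1, h2, h3⟩ := evalHom_dil_snd hA hd p ih.1 ih.2
    refine ⟨h1, fun i hi => ?_⟩
    rcases (Nat.lt_succ_iff.1 hi).lt_or_eq with hlt | rfl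
    · exact h2 i hlt
    · rw [h3, hp]; rfl

theorem IsGammaDistinguishedPoly.pow {p : MvPolynomial (Fin 2) ℂ}
    (hp : IsGammaDistinguishedPoly p) {n : ℕ} (hn : 1 ≤ n) : IsGammaDistinguishedPoly (p ^ n) := by
  induction n, hn using Nat.le_induction with
  | base => rwa [pow_one]
  | succ n _ ih => rw [pow_succ]; exact ih.mul hp

/-- `p` acts first and clears the component in `H`; then `q ^ n` clears the `n` following entries,
which is all that the projection retains. -/
theorem truncProj_mul_evalHom_dil_eq_zero (hSP : Commute S P) (hA : Commute A 0)
    (hd : Commute (dilT S P A) (dilV P)) {p q : MvPolynomial (Fin 2) ℂ}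
    (hp : evalHom hSP p = 0) (hq : evalHom hA q = 0) (n : ℕ) :
    truncProj H (defectSpace P) n * evalHom hd (q ^ n * p) = 0 := by
  refine ContinuousLinearMap.ext fun x => ?_
  rw [map_mul, mul_apply_eq_comp, mul_apply_eq_comp]
  have h0 : (evalHom hd p x).fst = 0 := by
    rw [evalHom_dil_fst hSP, hp, zero_apply]
  obtain ⟨e1, e2⟩ := evalHom_dil_pow_snd hA hd hq h0 n
  refine dilationSpace_ext e1 fun j => ?_
  rw [truncProj_snd]
  split_ifs with hj
  · exact e2 j hj
  · rfl

theorem isGammaDistinguished_trunc (h : IsFundamentalOperator S P A)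
    (hSP : IsGammaDistinguished S P) (hA0 : IsGammaDistinguished A 0) {n : ℕ} (hn : 1 ≤ n) :
    IsGammaDistinguished (truncT S P A n) (truncV P n) := by
  obtain ⟨hSP, p₁, hp₁, hp₁'⟩ := hSP
  obtain ⟨hA0, p₂, hp₂, hp₂'⟩ := hA0
  rw [← evalHom_apply hSP.commute] at hp₁'
  rw [← evalHom_apply hA0.commute] at hp₂'
  have hpair := isToeplitzPair_dilT_dilV h hSP.commute hSP.norm_snd_le
  rw [truncT_eq hn, truncV_eq hn]
  refine isGammaDistinguished_compression hpair.commute (truncProj_mul_self n)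
    (truncProj_mul_dilT n) (truncProj_mul_dilV n) (norm_sq_truncProj_add n)
    (hpair.norm_evalHom_le (norm_dilT_le h hSP hA0)) ((hp₂.pow hn).mul hp₁)
    (truncProj_mul_evalHom_dil_eq_zero hSP.commute hA0.commute hpair.commute hp₁' hp₂' n)

theorem tendsto_truncT (x : dilationSpace H (defectSpace P)) :
    Tendsto (fun n => truncT S P A n x) atTop (𝓝 (dilT S P A x)) := by
  have h1 : Tendsto (fun n => (S x.fst, colC P A x.fst + truncOp n (toeplitzD A x.snd))) atTop
      (𝓝 (S x.fst, colC P A x.fst + toeplitzD A x.snd)) :=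
    tendsto_const_nhds.prodMk_nhds (tendsto_const_nhds.add (tendsto_truncOp _))
  exact ((WithLp.prodContinuousLinearEquiv 2 ℂ H
    (ell2 (defectSpace P))).symm.continuous.tendsto _).comp h1

theorem tendsto_truncV (x : dilationSpace H (defectSpace P)) :
    Tendsto (fun n => truncV P n x) atTop (𝓝 (dilV P x)) := by
  have h1 : Tendsto (fun n => (P x.fst, colB P x.fst + truncOp n (shiftOp x.snd))) atTop
      (𝓝 (P x.fst, colB P x.fst + shiftOp x.snd)) :=
    tendsto_const_nhds.prodMk_nhds (tendsto_const_nhds.add (tendsto_truncOp _))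
  exact ((WithLp.prodContinuousLinearEquiv 2 ℂ H
    (ell2 (defectSpace P))).symm.continuous.tendsto _).comp h1

end Dilation

theorem lemma7p9 {H : Type*} [NormedAddCommGroup H] [InnerProductSpace ℂ H] [CompleteSpace H]
    (S P : H →L[ℂ] H) (A : defectSpace P →L[ℂ] defectSpace P)
    (hA : IsFundamentalOperator S P A)
    (hSP : IsGammaDistinguished S P)
    (hA0 : IsGammaDistinguished A 0) :
    (∀ n : ℕ, 1 ≤ n → IsGammaDistinguished (truncT S P A n) (truncV P n)) ∧
    (∀ x : dilationSpace H (defectSpace P),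
      Tendsto (fun n => truncT S P A n x) atTop (𝓝 (dilT S P A x))) ∧
    (∀ x : dilationSpace H (defectSpace P),
      Tendsto (fun n => truncV P n x) atTop (𝓝 (dilV P x))) :=
  ⟨fun _ hn => isGammaDistinguished_trunc hA hSP hA0 hn, tendsto_truncT, tendsto_truncV⟩

end
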